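/- Let $m\ge 0$ and $k\ge 1$ be integers, let $B$ be a real $m\times m$ matrix none of whose complex eigenvalues lies on the imaginary axis, and let $g:D\to\mathbb{R}^m$ be of class $C^k$ on an open neighbourhood $D$ of the origin in $\mathbb{R}\times\mathbb{R}^m$. Let $r$ be the number of eigenvalues of $B$ with negative real part, counted with algebraic multiplicity. Then the singular system $$ z\,y'(z) + B\,y(z) = z\,g(z,y(z)) \qquad (*)$$ admits an $r$-parameter family of local $C^k$ solutions $y:(0,\delta)\to\mathbb{R}^m$ with $\lim_{z\to 0^+}y(z)=0$, in the following sense. There are $\delta_0>0$ and $\rho>0$ such that for every $0<\delta\le\delta_0$ there are an open neighbourhood $V$ of $0$ in $\mathbb{R}^r$ and a $C^k$ map $Y:V\times(0,\delta)\to\mathbb{R}^m$ with the following properties. 1. For every $b\in V$ the function $y=Y(b,\cdot)$ is a solution of $(*)$ on $(0,\delta)$ (with $(z,y(z))\in D$ for all $z\in(0,\delta)$) and $y(z)\to 0$ as $z\to 0^+$. 2. The parametrization is non-degenerate: for every $z\in(0,\delta)$ the map $b\mapsto Y(b,z)$ is injective on $V$, and its derivative has rank $r$ at every point of $V$. 3.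 The family contains all small solutions: if $y:(0,\delta)\to\mathbb{R}^m$ is a solution of $(*)$ with $y(z)\to 0$ as $z\to0^+$ and $\|y(z)\|<\rho$ (maximum norm) for all $z\in(0,\delta)$, then $y=Y(b,\cdot)$ on $(0,\delta)$ for some $b\in V$. -/

import Mathlib

open Set Filter Topology

/-- The complex eigenvalues of a real square matrix `B`, each one repeated according to its
algebraic multiplicity. -/
noncomputable def complexEigenvalues {m : ℕ} (B : Matrix (Fin m) (Fin m) ℝ) : Multiset ℂ :=
  (B.map (algebraMap ℝ ℂ)).charpoly.roots

/-- The number of eigenvalues of `B` with negative real part, counted with algebraic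
multiplicity. -/
noncomputable def numNegEigenvalues {m : ℕ} (B : Matrix (Fin m) (Fin m) ℝ) : ℕ :=
  ((complexEigenvalues B).filter (fun l => l.re < 0)).card

/-- No (complex) eigenvalue of `B` lies on the imaginary axis. -/
def NoImaginaryEigenvalue {m : ℕ} (B : Matrix (Fin m) (Fin m) ℝ) : Prop :=
  ∀ l : ℂ, Module.End.HasEigenvalue (Matrix.toLin' (B.map (algebraMap ℝ ℂ))) l → l.re ≠ 0

/-- `y` is a local solution on `(0, δ)` of `z y' + B y = z g(z, y)`, where `g` is defined
on `D`, with `y(z) → 0` as `z → 0+`. -/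
structure IsSolutionVanishingAtZero {m : ℕ} (B : Matrix (Fin m) (Fin m) ℝ)
    (D : Set (ℝ × (Fin m → ℝ))) (g : ℝ × (Fin m → ℝ) → (Fin m → ℝ))
    (δ : ℝ) (y : ℝ → (Fin m → ℝ)) : Prop where
  /-- the graph of `y` stays in the domain of `g` -/
  mem_domain : ∀ z ∈ Ioo 0 δ, (z, y z) ∈ D
  /-- `y` is differentiable on `(0, δ)` and satisfies the equation there -/
  equation : ∀ z ∈ Ioo 0 δ, ∃ y' : Fin m → ℝ, HasDerivAt y y' z ∧
    z • y' + B.mulVec (y z) = z • g (z, y z)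
  /-- `y(z) → 0` as `z → 0+` -/
  tendsto_zero : Tendsto y (𝓝[>] 0) (𝓝 0)

/-- `Y b`, for `b` in the open neighbourhood `V` of the origin of `ℝ^r`, is a (genuinely)
`r`-parameter family, of class `C^k`, of solutions on `(0, δ)` which vanish at zero.
(Joint smoothness contains that each single solution `Y b` is `C^k` on `(0, δ)`.) -/
structure IsParameterFamily {m : ℕ} (B : Matrix (Fin m) (Fin m) ℝ)
    (D : Set (ℝ × (Fin m → ℝ))) (g : ℝ × (Fin m → ℝ) → (Fin m → ℝ)) (k r : ℕ)
    (δ : ℝ) (V : Set (Fin r → ℝ)) (Y : (Fin r → ℝ) → ℝ → (Fin m → ℝ)) : Prop where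
  isOpen : IsOpen V
  zero_mem : (0 : Fin r → ℝ) ∈ V
  /-- every member is a solution with limit `0` -/
  solution : ∀ b ∈ V, IsSolutionVanishingAtZero B D g δ (Y b)
  /-- `(b, z) ↦ Y b z` is of class `C^k` on `V × (0, δ)` -/
  contDiffOn : ContDiffOn ℝ k (fun p : (Fin r → ℝ) × ℝ => Y p.1 p.2) (V ×ˢ Ioo 0 δ)
  /-- different parameters give solutions which differ at every point of `(0, δ)` -/
  injOn : ∀ z ∈ Ioo 0 δ, InjOn (fun b => Y b z) V
  /-- the derivative with respect to the parameters has rank `r` everywhere -/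
  injective_fderiv : ∀ z ∈ Ioo 0 δ, ∀ b ∈ V,
    Function.Injective (fderiv ℝ (fun b' => Y b' z) b)

/-! Put `z = δ exp (-t)` and `u(t) = y(z)`. The singular equation becomes `u' = B u - ζ g(ζ, u)`
with `ζ = δ exp (-t)` on the half-line `t > 0`, and solutions vanishing at `z = 0` become orbits
tending to `0` at infinity. The linear part is hyperbolic and the forcing has size `δ`, so the
Lyapunov-Perron method applies: after cutting `g` off to a compactly supported `G`, the bounded
orbits with prescribed stable component `P (u 0)` are the fixed points of an integral operator,
`HasExpDichotomy.orbitMap`, on bounded continuous functions, a contraction for small `δ`. The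
parameter is that stable component, hence ranges over the range of the spectral projection `P`. This
`P` is a polynomial in `B`, and its rank is its trace, the number of eigenvalues with negative real
part.

Joint smoothness in parameter and time comes from rescaling time. The curve `t ↦ U b (μ t)` is a
fixed point of the operator with parameters `(μ, b)`, so `contDiffAt_fixedPoint` makes it a `C^k`
function of `(μ, b)` into the function space; evaluating at a fixed `t₀` with `μ = t / t₀` recovers
`U b t`. The ingredients are smoothness of superposition operators (`contDiff_superposition`) and of
the curve `δ exp (-μ t)` in `μ` (`contDiffAt_decayCurve`).

A Grönwall estimate backwards in time bounds the parameter difference by the distance of two orbits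
at any one time, which gives both injectivity and full rank. Conversely, a small solution is a
bounded orbit that extends to `t = 0`, hence is the fixed point belonging to its own stable
component there. -/

/-! ### Spectral mapping with multiplicities, and the real spectral projection. -/

section MatrixPolynomial
open Polynomial Matrix

variable {n : Type*} [Fintype n] [DecidableEq n]

theorem Matrix.det_sub_scalar_eq_prod (A : Matrix n n ℂ) (a : ℂ) :
    (A - algebraMap ℂ _ a).det = (A.charpoly.roots.map fun l => l - a).prod := by
  have h1 := A.eval_charpoly a
  have h2 := (IsAlgClosed.splits A.charpoly).eq_prod_roots
  rw [A.charpoly_monic.leadingCoeff, C_1, one_mul] at h2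
  have hcard : A.charpoly.roots.card = Fintype.card n := by
    rw [← (IsAlgClosed.splits A.charpoly).natDegree_eq_card_roots, charpoly_natDegree_eq_dim]
  have h3 : (A - algebraMap ℂ _ a) = -(Matrix.scalar n a - A) := by
    rw [neg_sub]; rfl
  rw [h3, det_neg, ← h1, h2, eval_multiset_prod, Multiset.map_map, ← hcard, ← h2]
  have : ((-1 : ℂ) ^ A.charpoly.roots.card) =
      (A.charpoly.roots.map fun _ => (-1 : ℂ)).prod := by simp
  rw [this, ← Multiset.prod_map_mul]
  simp

/-- Both sides are multiplicative in `q`, so splitting `q` over ℂ reduces the claim to linear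
factors. -/
theorem Matrix.det_aeval_eq_prod (A : Matrix n n ℂ) (q : ℂ[X]) :
    (aeval A q).det = (A.charpoly.roots.map fun l => q.eval l).prod := by
  have hcard : A.charpoly.roots.card = Fintype.card n := by
    rw [← (IsAlgClosed.splits A.charpoly).natDegree_eq_card_roots, charpoly_natDegree_eq_dim]
  have key : ∀ s : Multiset ℂ, (aeval A (s.map fun a => X - C a).prod).det =
      (A.charpoly.roots.map fun l => ((s.map fun a => X - C a).prod).eval l).prod := by
    intro s
    induction s using Multiset.induction with
    | empty => simp
    | cons a s ih =>
      simp only [Multiset.map_cons, Multiset.prod_cons, map_mul, det_mul, ih, map_sub, aeval_X,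
        aeval_C, det_sub_scalar_eq_prod, eval_mul, eval_sub, eval_X, eval_C,
        Multiset.prod_map_mul]
  have h2 := (IsAlgClosed.splits q).eq_prod_roots
  rw [h2, map_mul, det_mul, key, aeval_C]
  simp only [eval_mul, eval_C, Multiset.prod_map_mul]
  congr 1
  simp [algebraMap_eq_diagonal, hcard]

/-- At each `x` this is the determinant formula applied to the polynomial `x - q`. Its consequence
for the trace is what computes the rank of the projection. -/
theorem Matrix.charpoly_aeval (A : Matrix n n ℂ) (q : ℂ[X]) :
    (aeval A q).charpoly = ((A.charpoly.roots.map fun l => q.eval l).map fun a => X - C a).prod := by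
  refine Polynomial.funext fun x => ?_
  rw [eval_charpoly, eval_multiset_prod]
  have h : Matrix.scalar n x - aeval A q = aeval A (C x - q) := by
    rw [map_sub, aeval_C]; rfl
  rw [h, det_aeval_eq_prod]
  simp

theorem Matrix.trace_aeval (A : Matrix n n ℂ) (q : ℂ[X]) :
    (aeval A q).trace = (A.charpoly.roots.map fun l => q.eval l).sum := by
  rw [trace_eq_sum_roots_charpoly, charpoly_aeval, roots_multiset_prod_X_sub_C]

theorem Polynomial.exists_real_of_map_conj_eq (s : Multiset ℂ)
    (hs : s.map (starRingEnd ℂ) = s) :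
    ∃ p : ℝ[X], p.map (algebraMap ℝ ℂ) = (s.map fun a => X - C a).prod := by
  set P : ℂ[X] := (s.map fun a => X - C a).prod with hP
  have hconj : P.map (starRingEnd ℂ) = P := by
    rw [hP, Polynomial.map_multiset_prod, Multiset.map_map]
    conv_rhs => rw [← hs, Multiset.map_map]
    simp
  have : P ∈ lifts (algebraMap ℝ ℂ) := by
    rw [lifts_iff_coeff_lifts]
    intro k
    have h1 : (starRingEnd ℂ) (P.coeff k) = P.coeff k := by
      conv_rhs => rw [← hconj, coeff_map]
    obtain ⟨r, hr⟩ := Complex.conj_eq_iff_real.1 h1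
    exact ⟨r, hr.symm⟩
  obtain ⟨p, hp⟩ := this
  exact ⟨p, hp⟩

theorem Polynomial.map_conj_aroots (p : ℝ[X]) :
    (p.map (algebraMap ℝ ℂ)).roots.map (starRingEnd ℂ) = (p.map (algebraMap ℝ ℂ)).roots := by
  rw [← (IsAlgClosed.splits (p.map (algebraMap ℝ ℂ))).roots_map, Polynomial.map_map]
  congr 2
  ext x
  simp

theorem Multiset.map_conj_filter (s : Multiset ℂ) (hs : s.map (starRingEnd ℂ) = s)
    (p : ℂ → Prop) [DecidablePred p] (hp : ∀ z, p (starRingEnd ℂ z) ↔ p z) :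
    (s.filter p).map (starRingEnd ℂ) = s.filter p := by
  conv_rhs => rw [← hs, Multiset.filter_map]
  congr 1
  exact Multiset.filter_congr fun z _ => (hp z).symm

theorem Polynomial.eval_multiset_prod_X_sub_C_eq_zero_iff {R : Type*} [CommRing R] [IsDomain R]
    (s : Multiset R) (z : R) : eval z (s.map fun a => X - C a).prod = 0 ↔ z ∈ s := by
  simp [eval_multiset_prod, Multiset.prod_eq_zero_iff, sub_eq_zero]

/-- The spectral projection of a real hyperbolic matrix, as a polynomial in that matrix. -/
theorem exists_spectral_projection {m : ℕ} (B : Matrix (Fin m) (Fin m) ℝ) :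
    ∃ (q p₁ p₂ : ℝ[X]), IsIdempotentElem (aeval B q) ∧
      p₁.map (algebraMap ℝ ℂ) =
        (((complexEigenvalues B).filter fun l => l.re < 0).map fun a => X - C a).prod ∧
      p₂.map (algebraMap ℝ ℂ) =
        (((complexEigenvalues B).filter fun l => ¬ l.re < 0).map fun a => X - C a).prod ∧
      aeval B (p₁ * q) = 0 ∧ aeval B (p₂ * (1 - q)) = 0 ∧
      Module.finrank ℝ (LinearMap.range (Matrix.toLin' (aeval B q))) = numNegEigenvalues B := by
  have hroots : complexEigenvalues B = (B.charpoly.map (algebraMap ℝ ℂ)).roots := by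
    rw [complexEigenvalues, charpoly_map]
  have hconj := B.charpoly.map_conj_aroots
  rw [← hroots] at hconj
  set s := complexEigenvalues B with hs
  obtain ⟨p₁, hp₁⟩ := Polynomial.exists_real_of_map_conj_eq _
    (s.map_conj_filter hconj (fun l => l.re < 0) (by simp))
  obtain ⟨p₂, hp₂⟩ := Polynomial.exists_real_of_map_conj_eq _
    (s.map_conj_filter hconj (fun l => ¬ l.re < 0) (by simp))
  have hmem₁ : ∀ z : ℂ, aeval z p₁ = 0 → z.re < 0 := by
    intro z hz
    rw [aeval_def, ← eval_map, hp₁, eval_multiset_prod_X_sub_C_eq_zero_iff] at hz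
    exact (Multiset.mem_filter.1 hz).2
  have hmem₂ : ∀ z : ℂ, aeval z p₂ = 0 → ¬ z.re < 0 := by
    intro z hz
    rw [aeval_def, ← eval_map, hp₂, eval_multiset_prod_X_sub_C_eq_zero_iff] at hz
    exact (Multiset.mem_filter.1 hz).2
  have hprod : p₁ * p₂ = B.charpoly := by
    apply Polynomial.map_injective (algebraMap ℝ ℂ) (algebraMap ℝ ℂ).injective
    rw [Polynomial.map_mul, hp₁, hp₂, ← Multiset.prod_add, ← Multiset.map_add,
      Multiset.filter_add_not, hroots]
    have h2 := (IsAlgClosed.splits (B.charpoly.map (algebraMap ℝ ℂ))).eq_prod_roots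
    rw [(B.charpoly_monic.map _).leadingCoeff, C_1, one_mul] at h2
    exact h2.symm
  have hcop : IsCoprime p₁ p₂ := by
    rw [isCoprime_iff_aeval_ne_zero_of_isAlgClosed ℝ ℂ]
    intro a
    by_contra! h
    exact hmem₂ a h.2 (hmem₁ a h.1)
  -- By Bézout, `b * p₂ = 1 - a * p₁` takes the value `1` at the roots of `p₁` and `0` at those of
  -- `p₂`; it is idempotent at `B` because `p₁ * p₂` annihilates `B`.
  obtain ⟨a, b, hab⟩ := hcop
  have hchar : aeval B (p₁ * p₂) = 0 := by rw [hprod, aeval_self_charpoly]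
  have h1q : 1 - b * p₂ = a * p₁ := by rw [← hab]; ring
  have hidem₀ : IsIdempotentElem (aeval B (b * p₂)) := by
    have : (b * p₂) * (b * p₂) = b * p₂ - a * b * (p₁ * p₂) := by
      linear_combination (b * p₂) * hab
    rw [IsIdempotentElem, ← map_mul, this, map_sub, map_mul _ (a * b), hchar, mul_zero, sub_zero]
  refine ⟨b * p₂, p₁, p₂, hidem₀, hp₁, hp₂, ?_, ?_, ?_⟩
  · rw [show p₁ * (b * p₂) = b * (p₁ * p₂) by ring, map_mul, hchar, mul_zero]
  · rw [h1q, show p₂ * (a * p₁) = a * (p₁ * p₂) by ring, map_mul, hchar, mul_zero]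
  · set q := b * p₂
    have hidem : IsIdempotentElem (Matrix.toLin' (aeval B q)) := by
      rw [IsIdempotentElem, Module.End.mul_eq_comp, ← Matrix.toLin'_mul, hidem₀.eq]
    -- The rank of an idempotent is its trace, which is then computed over ℂ as the sum of `q` over
    -- the eigenvalues.
    have htr := (LinearMap.IsIdempotentElem.isProj_range _ hidem).trace
    rw [Matrix.trace_toLin'_eq] at htr
    have h3 : (algebraMap ℝ ℂ) ((aeval B q).trace) = (numNegEigenvalues B : ℂ) := by
      have : (algebraMap ℝ ℂ) ((aeval B q).trace) =
          (aeval (B.map (algebraMap ℝ ℂ)) (q.map (algebraMap ℝ ℂ))).trace := by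
        rw [aeval_map_algebraMap]
        have h := aeval_algHom_apply (AlgHom.mapMatrix (m := Fin m) (Algebra.ofId ℝ ℂ)) B q
        have h' : (AlgHom.mapMatrix (m := Fin m) (Algebra.ofId ℝ ℂ)) B =
          B.map (algebraMap ℝ ℂ) := rfl
        rw [h'] at h
        rw [h]
        exact AddMonoidHom.map_trace (algebraMap ℝ ℂ).toAddMonoidHom _
      rw [this, Matrix.trace_aeval]
      change (s.map _).sum = _
      rw [numNegEigenvalues, ← hs, ← Multiset.filter_add_not (fun l : ℂ => l.re < 0) s,
        Multiset.map_add, Multiset.sum_add]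
      have e1 : ((s.filter fun l => l.re < 0).map fun l => (q.map (algebraMap ℝ ℂ)).eval l) =
          (s.filter fun l => l.re < 0).map fun _ => (1 : ℂ) := by
        refine Multiset.map_congr rfl fun l hl => ?_
        have h1 : (p₁.map (algebraMap ℝ ℂ)).eval l = 0 := by
          rw [hp₁, eval_multiset_prod_X_sub_C_eq_zero_iff]; exact hl
        have h2 := congrArg (fun p : ℝ[X] => (p.map (algebraMap ℝ ℂ)).eval l) h1q
        simp only [Polynomial.map_sub, Polynomial.map_one, Polynomial.map_mul, eval_sub, eval_one,
          eval_mul, h1, mul_zero] at h2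
        linear_combination -h2
      have e2 : ((s.filter fun l => ¬ l.re < 0).map fun l => (q.map (algebraMap ℝ ℂ)).eval l) =
          (s.filter fun l => ¬ l.re < 0).map fun _ => (0 : ℂ) := by
        refine Multiset.map_congr rfl fun l hl => ?_
        have h1 : (p₂.map (algebraMap ℝ ℂ)).eval l = 0 := by
          rw [hp₂, eval_multiset_prod_X_sub_C_eq_zero_iff]; exact hl
        simp only [q, Polynomial.map_mul, eval_mul, h1, mul_zero]
      rw [e1, e2]
      simp
    rw [htr] at h3
    exact Nat.cast_injective (R := ℂ) (by simpa using h3)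

end MatrixPolynomial

/-! ### Exponential decay from an annihilating polynomial. -/

section Decay
open Polynomial

/-- Induction on the roots replaces the Jordan form: `(A - l) x` solves the same equation and is
killed by the remaining factors, so it decays, and integrating once recovers `x`. Repeated roots
cost no polynomial factor because the rate `a` is strictly below every `-e * l.re`. The scalar `e`
is `1` or `-1` in the applications and chooses the direction of time. -/
theorem HasDerivAt.exists_norm_le_exp_of_prod_mul_eq_zero {𝔸 : Type*} [NormedRing 𝔸]
    [NormedAlgebra ℂ 𝔸] (A : 𝔸) (e : ℝ) (a : ℝ) (s : Multiset ℂ)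
    (hs : ∀ l ∈ s, e * l.re < -a) :
    ∀ x : ℝ → 𝔸, (∀ t, HasDerivAt x ((e : ℂ) • (A * x t)) t) →
      (∀ t, aeval A (s.map fun l => X - C l).prod * x t = 0) →
      ∃ c, 0 ≤ c ∧ ∀ t, 0 ≤ t → ‖x t‖ ≤ c * Real.exp (-a * t) := by
  induction s using Multiset.induction with
  | empty =>
    intro x _ h
    refine ⟨0, le_rfl, fun t _ => ?_⟩
    have := h t
    simp at this
    simp [this]
  | cons l s ih =>
    intro x hx h
    have hl : e * l.re < -a := hs l (Multiset.mem_cons_self l s)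
    set w : ℝ → 𝔸 := fun t => A * x t - l • x t with hw
    have hw' : ∀ t, HasDerivAt w ((e : ℂ) • (A * w t)) t := by
      intro t
      have := ((hx t).const_mul A).sub ((hx t).const_smul l)
      refine this.congr_deriv ?_
      simp only [hw, mul_sub, mul_smul_comm, smul_sub]
      rw [smul_comm l]
    obtain ⟨c, hc0, hc⟩ := ih (fun l' hl' => hs l' (Multiset.mem_cons_of_mem hl')) w hw' (by
      intro t
      have := h t
      rw [Multiset.map_cons, Multiset.prod_cons, mul_comm, map_mul, mul_assoc] at this
      rw [← this]
      congr 1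
      simp [hw, sub_mul, Algebra.smul_def])
    set ρ := -(e * l.re) - a with hρ
    have hρ0 : 0 < ρ := by linarith
    set y : ℝ → 𝔸 := fun t => Complex.exp (-(e * l) * t) • x t with hy
    have hy' : ∀ t : ℝ, HasDerivAt y (Complex.exp (-(e * l) * t) • ((e : ℂ) • w t)) t := by
      intro t
      have h1 : HasDerivAt (fun t : ℝ => Complex.exp (-(e * l) * t))
          (Complex.exp (-(e * l) * t) * (-(e * l))) t := by
        have h0 : HasDerivAt (fun t : ℝ => (-(e * l) : ℂ) * t) (-(e * l)) t := by
          simpa using (HasDerivAt.ofReal_comp (hasDerivAt_id t)).const_mul (-(e * l) : ℂ)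
        exact h0.cexp
      refine (h1.smul (hx t)).congr_deriv ?_
      simp only [hw, smul_sub, smul_smul]
      rw [sub_eq_add_neg, ← neg_smul]
      congr 2
      ring
    have hnexp : ∀ t : ℝ, ‖Complex.exp (-(e * l) * t)‖ = Real.exp (-(e * l.re) * t) := by
      intro t
      rw [Complex.norm_exp]
      congr 1
      simp
    set k := |e| * c / ρ with hk
    have hk0 : 0 ≤ k := by positivity
    refine ⟨‖x 0‖ + k, by positivity, fun t ht => ?_⟩
    -- The integrating factor removes the term in `l`, and what is left of the derivative has norm
    -- at most `|e| * c * exp (ρ t)`, the derivative of the comparison function.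
    have hbd : ‖y t‖ ≤ ‖x 0‖ + k * (Real.exp (ρ * t) - 1) := by
      refine image_norm_le_of_norm_deriv_right_le_deriv_boundary (a := 0) (b := t)
        (f' := fun t => Complex.exp (-(e * l) * t) • ((e : ℂ) • w t))
        (B := fun t => ‖x 0‖ + k * (Real.exp (ρ * t) - 1))
        (B' := fun t => k * (Real.exp (ρ * t) * ρ))
        (fun t _ => (hy' t).continuousAt.continuousWithinAt)
        (fun t _ => (hy' t).hasDerivWithinAt) ?_ ?_ ?_ ⟨ht, le_rfl⟩
      · simp [hy]
      · intro t
        have h0 : HasDerivAt (fun t : ℝ => ρ * t) ρ t := by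
          simpa using (hasDerivAt_id t).const_mul ρ
        exact ((h0.exp.sub_const 1).const_mul k).const_add _
      · intro t ht
        rw [norm_smul, norm_smul, hnexp, Complex.norm_real, Real.norm_eq_abs]
        calc _ ≤ Real.exp (-(e * l.re) * t) * (|e| * (c * Real.exp (-a * t))) := by
              gcongr; exact hc t ht.1
          _ = |e| * c * (Real.exp (-(e * l.re) * t) * Real.exp (-a * t)) := by ring
          _ = |e| * c * Real.exp (ρ * t) := by
              rw [← Real.exp_add, hρ]; ring_nf
          _ = _ := by rw [hk]; field_simp
    have hyx : ‖x t‖ = Real.exp (e * l.re * t) * ‖y t‖ := by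
      rw [hy, norm_smul, hnexp, ← mul_assoc, ← Real.exp_add]
      simp
    rw [hyx]
    have e1 : Real.exp (e * l.re * t) ≤ Real.exp (-a * t) := by
      apply Real.exp_le_exp.2; exact mul_le_mul_of_nonneg_right hl.le ht
    have e2 : Real.exp (e * l.re * t) * Real.exp (ρ * t) = Real.exp (-a * t) := by
      rw [← Real.exp_add, hρ]; ring_nf
    have e3 := Real.exp_pos (e * l.re * t)
    calc _ ≤ Real.exp (e * l.re * t) * (‖x 0‖ + k * (Real.exp (ρ * t) - 1)) := by gcongr
      _ ≤ Real.exp (e * l.re * t) * ‖x 0‖ + k * (Real.exp (e * l.re * t) * Real.exp (ρ * t)) := by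
          nlinarith [mul_nonneg hk0 e3.le]
      _ ≤ Real.exp (-a * t) * ‖x 0‖ + k * Real.exp (-a * t) := by rw [e2]; gcongr
      _ = _ := by ring

end Decay

/-! ### Exponential dichotomy of a hyperbolic matrix. -/

section Dichotomy
open Polynomial NormedSpace

/-- `A` has an exponential dichotomy with projection `P` onto its stable subspace. -/
structure HasExpDichotomy {E : Type*} [NormedAddCommGroup E] [NormedSpace ℝ E]
    (A P : E →L[ℝ] E) (a c : ℝ) : Prop where
  rate_pos : 0 < a
  const_nonneg : 0 ≤ c
  comm : Commute P A
  idem : P * P = P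
  stable : ∀ t : ℝ, 0 ≤ t → ‖exp (t • A) * P‖ ≤ c * Real.exp (-a * t)
  unstable : ∀ t : ℝ, 0 ≤ t → ‖exp ((-t) • A) * (1 - P)‖ ≤ c * Real.exp (-a * t)

/-- Square matrices as continuous endomorphisms. -/
noncomputable def matrixCLM (𝕜 : Type*) [RCLike 𝕜] (n : Type*) [Fintype n] [DecidableEq n] :
    Matrix n n 𝕜 ≃ₐ[𝕜] ((n → 𝕜) →L[𝕜] (n → 𝕜)) :=
  Matrix.toLinAlgEquiv'.trans (Module.End.toContinuousLinearMap (n → 𝕜))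

/-- Complexification of real endomorphisms of `ℝ^n`. -/
noncomputable def complexifyCLM (n : Type*) [Fintype n] [DecidableEq n] :
    ((n → ℝ) →L[ℝ] (n → ℝ)) →ₐ[ℝ] ((n → ℂ) →L[ℂ] (n → ℂ)) :=
  ((matrixCLM ℂ n).toAlgHom.restrictScalars ℝ).comp
    ((AlgHom.mapMatrix (Algebra.ofId ℝ ℂ)).comp (matrixCLM ℝ n).symm.toAlgHom)

theorem complexifyCLM_injective (n : Type*) [Fintype n] [DecidableEq n] :
    Function.Injective (complexifyCLM n) := by
  intro x y h
  exact (matrixCLM ℝ n).symm.injective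
    (Matrix.map_injective (algebraMap ℝ ℂ).injective ((matrixCLM ℂ n).injective h))

theorem Polynomial.commute_aeval_self {R S : Type*} [CommRing R] [Ring S] [Algebra R S]
    (p : R[X]) (A : S) : Commute (aeval A p) A := by
  simpa using (Commute.all p X).map (aeval A)

/-- The decay lemma needs complex roots, so it is applied after complexification; an injective
linear map of finite-dimensional spaces is antilipschitz, which brings the bound back to ℝ. -/
theorem exists_norm_exp_mul_le {m : ℕ} (A Q : (Fin m → ℝ) →L[ℝ] (Fin m → ℝ)) (e a : ℝ)
    (p : ℝ[X]) (s : Multiset ℂ) (hp : p.map (algebraMap ℝ ℂ) = (s.map fun l => X - C l).prod)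
    (hs : ∀ l ∈ s, e * l.re < -a) (hQ : aeval A p * Q = 0) :
    ∃ c, 0 ≤ c ∧ ∀ t : ℝ, 0 ≤ t → ‖exp ((e * t) • A) * Q‖ ≤ c * Real.exp (-a * t) := by
  set ι := complexifyCLM (Fin m)
  have hAe : ∀ t : ℝ, Commute A (exp (t • A)) := fun t =>
    ((Commute.refl A).smul_right t).exp_right
  have hx : ∀ t : ℝ, HasDerivAt (fun t : ℝ => exp ((e * t) • A) * Q)
      (e • (A * (exp ((e * t) • A) * Q))) t := by
    intro t
    have h1 : HasDerivAt (fun t : ℝ => e * t) e t := by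
      simpa using (hasDerivAt_id t).const_mul e
    have h2 := (hasDerivAt_exp_smul_const' A (e * t)).scomp t h1
    refine (h2.mul_const Q).congr_deriv ?_
    rw [smul_mul_assoc, mul_assoc]
  have hιc : Continuous ι := ι.toLinearMap.continuous_of_finiteDimensional
  let ιL : ((Fin m → ℝ) →L[ℝ] (Fin m → ℝ)) →L[ℝ] ((Fin m → ℂ) →L[ℂ] (Fin m → ℂ)) :=
    ⟨ι.toLinearMap, hιc⟩
  obtain ⟨c, hc0, hc⟩ := HasDerivAt.exists_norm_le_exp_of_prod_mul_eq_zero (ι A) e a s hs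
    (fun t => ι (exp ((e * t) • A) * Q)) (fun t => by
      refine (ιL.hasFDerivAt.comp_hasDerivAt t (hx t)).congr_deriv ?_
      change ι _ = _
      rw [map_smul, map_mul]
      simp) (fun t => by
      rw [← hp, aeval_map_algebraMap, aeval_algHom_apply, ← map_mul]
      have h1 : Commute (aeval A p) (exp ((e * t) • A)) :=
        ((p.commute_aeval_self A).smul_right _).exp_right
      rw [← mul_assoc, h1.eq, mul_assoc, hQ, mul_zero, map_zero])
  obtain ⟨K, hK, hanti⟩ := ι.toLinearMap.exists_antilipschitzWith
    (LinearMap.ker_eq_bot.2 (complexifyCLM_injective (Fin m)))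
  refine ⟨K * c, by positivity, fun t ht => ?_⟩
  have h1 := hanti.le_mul_norm (map_zero _) (exp ((e * t) • A) * Q)
  calc _ ≤ _ := h1
    _ ≤ K * (c * Real.exp (-a * t)) := by gcongr; exact hc t ht
    _ = _ := by ring

theorem NoImaginaryEigenvalue.re_ne_zero {m : ℕ} {B : Matrix (Fin m) (Fin m) ℝ}
    (hB : NoImaginaryEigenvalue B) {l : ℂ} (hl : l ∈ complexEigenvalues B) : l.re ≠ 0 := by
  refine hB l ?_
  rw [Module.End.hasEigenvalue_iff_mem_spectrum, Matrix.spectrum_toLin',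
    Matrix.mem_spectrum_iff_isRoot_charpoly]
  exact isRoot_of_mem_roots hl

theorem Multiset.exists_pos_lt_abs_re (s : Multiset ℂ) (hs : ∀ l ∈ s, l.re ≠ 0) :
    ∃ a : ℝ, 0 < a ∧ ∀ l ∈ s, a < |l.re| := by
  induction s using Multiset.induction with
  | empty => exact ⟨1, one_pos, by simp⟩
  | cons l s ih =>
    obtain ⟨a, ha, h⟩ := ih fun l' hl' => hs l' (Multiset.mem_cons_of_mem hl')
    have hl : 0 < |l.re| := abs_pos.2 (hs l (Multiset.mem_cons_self l s))
    refine ⟨min a (|l.re| / 2), by positivity, fun l' hl' => ?_⟩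
    rcases Multiset.mem_cons.1 hl' with rfl | hl'
    · exact (min_le_right _ _).trans_lt (half_lt_self hl)
    · exact (min_le_left _ _).trans_lt (h l' hl')

theorem NoImaginaryEigenvalue.exists_hasExpDichotomy {m : ℕ} {B : Matrix (Fin m) (Fin m) ℝ}
    (hB : NoImaginaryEigenvalue B) :
    ∃ (P : (Fin m → ℝ) →L[ℝ] (Fin m → ℝ)) (a c : ℝ),
      HasExpDichotomy (matrixCLM ℝ (Fin m) B) P a c ∧
      Module.finrank ℝ (LinearMap.range P.toLinearMap) = numNegEigenvalues B := by
  obtain ⟨q, p₁, p₂, hidem, hp₁, hp₂, h₁, h₂, hrank⟩ := exists_spectral_projection B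
  obtain ⟨a, ha, hre⟩ := (complexEigenvalues B).exists_pos_lt_abs_re fun l hl => hB.re_ne_zero hl
  set Φ := matrixCLM ℝ (Fin m)
  have hΦ : ∀ p : ℝ[X], aeval (Φ B) p = Φ (aeval B p) := fun p => aeval_algHom_apply Φ.toAlgHom B p
  obtain ⟨c₁, hc₁, hb₁⟩ := exists_norm_exp_mul_le (Φ B) (Φ (aeval B q)) 1 a p₁ _ hp₁ (by
    intro l hl
    obtain ⟨hl, hneg⟩ := Multiset.mem_filter.1 hl
    have := hre l hl
    rw [abs_of_neg hneg] at this
    linarith) (by rw [hΦ, ← map_mul, ← map_mul, h₁, map_zero])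
  obtain ⟨c₂, hc₂, hb₂⟩ := exists_norm_exp_mul_le (Φ B) (1 - Φ (aeval B q)) (-1) a p₂ _ hp₂ (by
    intro l hl
    obtain ⟨hl, hneg⟩ := Multiset.mem_filter.1 hl
    have := hre l hl
    rw [abs_of_nonneg (not_lt.1 hneg)] at this
    linarith) (by
      rw [hΦ, ← map_one Φ, ← map_sub, ← map_mul, ← map_one (aeval (R := ℝ) B), ← map_sub,
        ← map_mul, h₂, map_zero])
  refine ⟨Φ (aeval B q), a, max c₁ c₂, ⟨ha, le_max_of_le_left hc₁, ?_, ?_, ?_, ?_⟩, hrank⟩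
  · rw [← hΦ]; exact q.commute_aeval_self _
  · rw [← map_mul, hidem.eq]
  · intro t ht
    have := hb₁ t ht
    rw [one_mul] at this
    refine this.trans ?_
    gcongr
    exact le_max_left _ _
  · intro t ht
    have := hb₂ t ht
    rw [neg_one_mul] at this
    refine this.trans ?_
    gcongr
    exact le_max_right _ _

end Dichotomy

/-! ### The Green operator on the half-line and bounded solutions. -/

section Green
open MeasureTheory NormedSpace BoundedContinuousFunction
open scoped BoundedContinuousFunction

variable {E : Type*} [NormedAddCommGroup E] [NormedSpace ℝ E] {A P : E →L[ℝ] E} {a c : ℝ}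

namespace HasExpDichotomy

theorem commute_exp (hd : HasExpDichotomy A P a c) (t : ℝ) : Commute P (exp (t • A)) :=
  (hd.comm.smul_right t).exp_right

theorem norm_unstable_apply_le (hd : HasExpDichotomy A P a c) {s t : ℝ} (h : t ≤ s) (v : E) :
    ‖(exp ((t - s) • A) * (1 - P)) v‖ ≤ c * Real.exp (-a * (s - t)) * ‖v‖ := by
  have := hd.unstable (s - t) (sub_nonneg.2 h)
  rw [neg_sub] at this
  exact (ContinuousLinearMap.le_opNorm _ _).trans (by gcongr)

theorem norm_stable_apply_le (hd : HasExpDichotomy A P a c) {s t : ℝ} (h : s ≤ t) (v : E) :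
    ‖(exp ((t - s) • A) * P) v‖ ≤ c * Real.exp (-a * (t - s)) * ‖v‖ :=
  (ContinuousLinearMap.le_opNorm _ _).trans (by gcongr; exact hd.stable _ (sub_nonneg.2 h))

theorem norm_exp_smul_apply_le (hd : HasExpDichotomy A P a c) {t : ℝ} (ht : 0 ≤ t) (b : E) :
    ‖exp (t • A) (P b)‖ ≤ c * Real.exp (-a * t) * ‖b‖ := by
  simpa using hd.norm_stable_apply_le ht b

section Weighted

variable {f : ℝ → E} {β M : ℝ}

theorem norm_unstable_integrand_le (hd : HasExpDichotomy A P a c)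
    (hM : ∀ s, 0 ≤ s → ‖f s‖ ≤ M * Real.exp (-β * s)) {t s : ℝ} (ht : 0 ≤ t) (hs : t ≤ s) :
    ‖(exp ((t - s) • A) * (1 - P)) (f s)‖ ≤
      c * M * Real.exp (a * t) * Real.exp (-(a + β) * s) := by
  have hc := hd.const_nonneg
  calc _ ≤ _ := hd.norm_unstable_apply_le hs (f s)
    _ ≤ c * Real.exp (-a * (s - t)) * (M * Real.exp (-β * s)) := by
        gcongr; exact hM s (ht.trans hs)
    _ = c * M * (Real.exp (-a * (s - t)) * Real.exp (-β * s)) := by ring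
    _ = c * M * (Real.exp (a * t) * Real.exp (-(a + β) * s)) := by
        rw [← Real.exp_add, ← Real.exp_add]; ring_nf
    _ = _ := by ring

theorem norm_integral_stable_le (hd : HasExpDichotomy A P a c) (hβ : β < a)
    (hM : ∀ s, 0 ≤ s → ‖f s‖ ≤ M * Real.exp (-β * s)) {t : ℝ} (ht : 0 ≤ t) :
    ‖∫ s in (0 : ℝ)..t, (exp ((t - s) • A) * P) (f s)‖ ≤
      c * M / (a - β) * Real.exp (-β * t) := by
  have hc := hd.const_nonneg
  have hM0 : 0 ≤ M := by
    have := (norm_nonneg _).trans (hM 0 le_rfl)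
    simpa using this
  have hpos : 0 < a - β := sub_pos.2 hβ
  have h1 : ∀ s ∈ Ioc 0 t, ‖(exp ((t - s) • A) * P) (f s)‖ ≤
      c * M * Real.exp (-a * t) * Real.exp ((a - β) * s) := by
    intro s hs
    calc _ ≤ _ := hd.norm_stable_apply_le hs.2 (f s)
      _ ≤ c * Real.exp (-a * (t - s)) * (M * Real.exp (-β * s)) := by
          gcongr; exact hM s hs.1.le
      _ = c * M * (Real.exp (-a * (t - s)) * Real.exp (-β * s)) := by ring
      _ = c * M * (Real.exp (-a * t) * Real.exp ((a - β) * s)) := by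
          rw [← Real.exp_add, ← Real.exp_add]; ring_nf
      _ = _ := by ring
  refine (intervalIntegral.norm_integral_le_of_norm_le ht
    ((ae_restrict_iff' measurableSet_Ioc).1 ((ae_restrict_iff' measurableSet_Ioc).2
      (Eventually.of_forall h1)))
    (Continuous.intervalIntegrable (by fun_prop) _ _)).trans ?_
  have hd' : ∀ s ∈ uIcc 0 t, HasDerivAt (fun s => Real.exp ((a - β) * s) / (a - β))
      (Real.exp ((a - β) * s)) s := by
    intro s _
    have h0 : HasDerivAt (fun s : ℝ => (a - β) * s) (a - β) s := by
      simpa using (hasDerivAt_id s).const_mul (a - β)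
    refine (h0.exp.div_const _).congr_deriv ?_
    field_simp
  rw [intervalIntegral.integral_const_mul,
    intervalIntegral.integral_eq_sub_of_hasDerivAt hd'
      (Continuous.intervalIntegrable (by fun_prop) _ _)]
  have h2 : Real.exp (-β * t) = Real.exp (-a * t) * Real.exp ((a - β) * t) := by
    rw [← Real.exp_add]; ring_nf
  rw [h2, mul_zero, Real.exp_zero, ← sub_div]
  calc _ = c * M / (a - β) * (Real.exp (-a * t) * (Real.exp ((a - β) * t) - 1)) := by
        field_simp
    _ ≤ _ := by
        gcongr
        linarith

theorem norm_integral_unstable_le (hd : HasExpDichotomy A P a c) (hβ : 0 ≤ β)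
    (hM : ∀ s, 0 ≤ s → ‖f s‖ ≤ M * Real.exp (-β * s)) {t : ℝ} (ht : 0 ≤ t) :
    ‖∫ s in Ioi t, (exp ((t - s) • A) * (1 - P)) (f s)‖ ≤
      c * M / (a + β) * Real.exp (-β * t) := by
  have ha := hd.rate_pos
  have h1 : IntegrableOn (fun s => c * M * Real.exp (a * t) * Real.exp (-(a + β) * s)) (Ioi t) :=
    (integrableOn_exp_mul_Ioi (by linarith) t).const_mul _
  refine (norm_integral_le_of_norm_le h1 ((ae_restrict_iff' measurableSet_Ioi).2
    (Eventually.of_forall fun s hs => hd.norm_unstable_integrand_le hM ht (le_of_lt hs)))).trans ?_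
  rw [integral_const_mul, integral_exp_mul_Ioi (by linarith)]
  have : Real.exp (-β * t) = Real.exp (a * t) * Real.exp (-(a + β) * t) := by
    rw [← Real.exp_add]; ring_nf
  rw [this]
  apply le_of_eq
  have : a + β ≠ 0 := by positivity
  have : -a - β ≠ 0 := by rw [← neg_add']; exact neg_ne_zero.2 this
  field_simp

end Weighted

theorem norm_exp_smul_apply_le' (hd : HasExpDichotomy A P a c) {t : ℝ} (ht : 0 ≤ t) (b : E) :
    ‖exp (t • A) (P b)‖ ≤ c * ‖b‖ := by
  refine (hd.norm_exp_smul_apply_le ht b).trans ?_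
  have hc := hd.const_nonneg
  gcongr
  refine mul_le_of_le_one_right hc (Real.exp_le_one_iff.2 ?_)
  nlinarith [hd.rate_pos]

end HasExpDichotomy

/-- The initial value (up to sign) of the bounded solution of `u' = A u + f` whose stable component
vanishes at `0`. -/
noncomputable def greenInit (A P : E →L[ℝ] E) (f : ℝ → E) : E :=
  ∫ s in Ioi (0 : ℝ), (exp ((-s) • A) * (1 - P)) (f s)

/-- The solution of `u' = A u + f` on the half-line that is bounded (if `f` is) and whose stable
component vanishes at `0`. -/
noncomputable def greenFun (A P : E →L[ℝ] E) (f : ℝ → E) (t : ℝ) : E :=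
  exp (t • A) ((∫ s in (0 : ℝ)..t, exp ((-s) • A) (f s)) - greenInit A P f)

theorem greenFun_smul (A P : E →L[ℝ] E) (r : ℝ) (f : ℝ → E) (t : ℝ) :
    greenFun A P (r • f) t = r • greenFun A P f t := by
  simp only [greenFun, greenInit, Pi.smul_apply, map_smul, integral_smul,
    intervalIntegral.integral_smul, ← smul_sub]

variable [CompleteSpace E]

theorem hasDerivAt_exp_smul_apply (A : E →L[ℝ] E) {v : ℝ → E} {v' : E} {t : ℝ}
    (hv : HasDerivAt v v' t) :
    HasDerivAt (fun t => exp (t • A) (v t)) (A (exp (t • A) (v t)) + exp (t • A) v') t := by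
  exact (hasDerivAt_exp_smul_const' A t).clm_apply hv

theorem continuous_exp_smul (A : E →L[ℝ] E) : Continuous fun t : ℝ => exp (t • A) :=
  continuous_iff_continuousAt.2 fun t => (hasDerivAt_exp_smul_const' A t).continuousAt

theorem exp_smul_mul_exp_smul (A : E →L[ℝ] E) (s t : ℝ) :
    exp (s • A) * exp (t • A) = exp ((s + t) • A) := by
  let : NormedAlgebra ℚ (E →L[ℝ] E) := NormedAlgebra.restrictScalars ℚ ℝ _
  rw [add_smul, exp_add_of_commute]
  exact (Commute.refl A).smul_left s |>.smul_right t

theorem exp_smul_apply_exp_smul_apply (A : E →L[ℝ] E) (s t : ℝ) (v : E) :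
    exp (s • A) (exp (t • A) v) = exp ((s + t) • A) v := by
  rw [← exp_smul_mul_exp_smul]; rfl

theorem continuous_exp_neg_smul_apply (A : E →L[ℝ] E) {f : ℝ → E} (hf : Continuous f) :
    Continuous fun s : ℝ => exp ((-s) • A) (f s) :=
  ((continuous_exp_smul A).comp continuous_neg).clm_apply hf

theorem continuous_exp_smul_mul_apply (A Q : E →L[ℝ] E) {f : ℝ → E} (hf : Continuous f) (t : ℝ) :
    Continuous fun s : ℝ => (exp ((t - s) • A) * Q) (f s) :=
  (((continuous_exp_smul A).comp (continuous_const.sub continuous_id)).mul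
    continuous_const).clm_apply hf

theorem hasDerivAt_greenFun (A P : E →L[ℝ] E) {f : ℝ → E} (hf : Continuous f) (t : ℝ) :
    HasDerivAt (greenFun A P f) (A (greenFun A P f t) + f t) t := by
  have hc := continuous_exp_neg_smul_apply A hf
  have h1 : HasDerivAt (fun t => (∫ s in (0 : ℝ)..t, exp ((-s) • A) (f s)) - greenInit A P f)
      (exp ((-t) • A) (f t)) t :=
    (intervalIntegral.integral_hasDerivAt_right (hc.intervalIntegrable _ _)
      (hc.stronglyMeasurableAtFilter _ _) hc.continuousAt).sub_const _
  refine (hasDerivAt_exp_smul_apply A h1).congr_deriv ?_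
  rw [exp_smul_apply_exp_smul_apply, add_neg_cancel, zero_smul, exp_zero]
  rfl

namespace HasExpDichotomy

section Weighted

variable {f : ℝ → E} {β M : ℝ}

theorem integrableOn_unstable (hd : HasExpDichotomy A P a c) (hf : Continuous f) (hβ : 0 ≤ β)
    (hM : ∀ s, 0 ≤ s → ‖f s‖ ≤ M * Real.exp (-β * s)) {t : ℝ} (ht : 0 ≤ t) :
    IntegrableOn (fun s => (exp ((t - s) • A) * (1 - P)) (f s)) (Ioi t) := by
  have ha := hd.rate_pos
  have h1 : IntegrableOn (fun s => c * M * Real.exp (a * t) * Real.exp (-(a + β) * s)) (Ioi t) :=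
    (integrableOn_exp_mul_Ioi (by linarith) t).const_mul _
  refine h1.mono' (continuous_exp_smul_mul_apply A _ hf t).aestronglyMeasurable ?_
  refine (ae_restrict_iff' measurableSet_Ioi).2 (Eventually.of_forall fun s hs => ?_)
  exact hd.norm_unstable_integrand_le hM ht (le_of_lt hs)

/-- Subtracting `greenInit` cancels the growing unstable part of the variation-of-constants formula.
What remains is a kernel that decays on both sides of `s = t`, from which the weighted estimates
follow: `β = 0` gives boundedness, `β > 0` gives decay. -/
theorem greenFun_eq (hd : HasExpDichotomy A P a c) (hf : Continuous f) (hβ : 0 ≤ β)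
    (hM : ∀ s, 0 ≤ s → ‖f s‖ ≤ M * Real.exp (-β * s)) {t : ℝ} (ht : 0 ≤ t) :
    greenFun A P f t = (∫ s in (0 : ℝ)..t, (exp ((t - s) • A) * P) (f s)) -
      ∫ s in Ioi t, (exp ((t - s) • A) * (1 - P)) (f s) := by
  have hint₀ := hd.integrableOn_unstable hf hβ hM le_rfl
  simp only [zero_sub] at hint₀
  have hcP : ∀ Q : E →L[ℝ] E, Continuous fun s : ℝ => (exp ((-s) • A) * Q) (f s) := by
    intro Q
    simpa using continuous_exp_smul_mul_apply A Q hf 0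
  have hexp : ∀ (Q : E →L[ℝ] E) (s : ℝ),
      exp (t • A) ((exp ((-s) • A) * Q) (f s)) = (exp ((t - s) • A) * Q) (f s) := by
    intro Q s
    rw [mul_apply_eq_comp, exp_smul_apply_exp_smul_apply, ← sub_eq_add_neg]
    rfl
  have h1 : (∫ s in (0 : ℝ)..t, exp ((-s) • A) (f s)) =
      (∫ s in (0 : ℝ)..t, (exp ((-s) • A) * P) (f s)) +
        ∫ s in (0 : ℝ)..t, (exp ((-s) • A) * (1 - P)) (f s) := by
    rw [← intervalIntegral.integral_add ((hcP P).intervalIntegrable _ _)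
      ((hcP (1 - P)).intervalIntegrable _ _)]
    congr 1
    ext s
    rw [← _root_.add_apply, ← mul_add, add_sub_cancel, mul_one]
  have h2 : greenInit A P f = (∫ s in (0 : ℝ)..t, (exp ((-s) • A) * (1 - P)) (f s)) +
      ∫ s in Ioi t, (exp ((-s) • A) * (1 - P)) (f s) :=
    (intervalIntegral.integral_interval_add_Ioi hint₀
      (hint₀.mono_set (Ioi_subset_Ioi ht))).symm
  rw [greenFun, h1, h2, add_sub_assoc, sub_add_cancel_left, ← sub_eq_add_neg, map_sub,
    ← ContinuousLinearMap.intervalIntegral_comp_comm _ ((hcP P).intervalIntegrable _ _),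
    ← ContinuousLinearMap.integral_comp_comm _ (hint₀.mono_set (Ioi_subset_Ioi ht))]
  simp only [hexp]

theorem norm_greenFun_le (hd : HasExpDichotomy A P a c) (hf : Continuous f) (hβ : 0 ≤ β)
    (hβa : β < a) (hM : ∀ s, 0 ≤ s → ‖f s‖ ≤ M * Real.exp (-β * s)) {t : ℝ} (ht : 0 ≤ t) :
    ‖greenFun A P f t‖ ≤ 2 * c / (a - β) * M * Real.exp (-β * t) := by
  have hc := hd.const_nonneg
  have hM0 : 0 ≤ M := by
    have := (norm_nonneg _).trans (hM 0 le_rfl)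
    simpa using this
  have hpos : 0 < a - β := sub_pos.2 hβa
  rw [hd.greenFun_eq hf hβ hM ht]
  calc _ ≤ c * M / (a - β) * Real.exp (-β * t) + c * M / (a + β) * Real.exp (-β * t) :=
        (norm_sub_le _ _).trans
          (add_le_add (hd.norm_integral_stable_le hβa hM ht) (hd.norm_integral_unstable_le hβ hM ht))
    _ ≤ c * M / (a - β) * Real.exp (-β * t) + c * M / (a - β) * Real.exp (-β * t) := by
        gcongr
        linarith
    _ = _ := by ring

end Weighted

theorem apply_greenFun_zero (hd : HasExpDichotomy A P a c) {f : ℝ → E} (hf : Continuous f) {M : ℝ}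
    (hM : ∀ s, 0 ≤ s → ‖f s‖ ≤ M) : P (greenFun A P f 0) = 0 := by
  have hint₀ := hd.integrableOn_unstable hf le_rfl (β := 0) (M := M) (by simpa using hM) le_rfl
  simp only [zero_sub] at hint₀
  have : P (greenInit A P f) = 0 := by
    rw [greenInit, ← ContinuousLinearMap.integral_comp_comm _ hint₀]
    have : ∀ s : ℝ, P * (exp ((-s) • A) * (1 - P)) = 0 := by
      intro s
      rw [← mul_assoc, (hd.commute_exp _).eq, mul_assoc, mul_sub, mul_one, hd.idem, sub_self,
        mul_zero]
    simp only [← mul_apply_eq_comp, this]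
    simp
  simp [greenFun, this]

/-- Bounded solutions of `v' = A v` on the half-line are determined by their stable component at
`0`. -/
theorem eq_exp_smul_apply_of_bounded (hd : HasExpDichotomy A P a c) {w : ℝ → E}
    (hw : ContinuousOn w (Ici 0)) (hw' : ∀ t, 0 < t → HasDerivAt w (A (w t)) t) {M : ℝ}
    (hM : ∀ t, 0 ≤ t → ‖w t‖ ≤ M) {t : ℝ} (ht : 0 ≤ t) : w t = exp (t • A) (P (w 0)) := by
  have hconst : ∀ t, 0 ≤ t → exp ((-t) • A) (w t) = w 0 := by
    intro t ht
    have h1 : ContinuousOn (fun s : ℝ => exp ((-s) • A) (w s)) (Icc 0 t) :=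
      ((continuous_exp_smul A).comp continuous_neg).continuousOn.clm_apply
        (hw.mono Icc_subset_Ici_self)
    have h2 : ∀ s ∈ Ioo 0 t, HasDerivAt (fun s : ℝ => exp ((-s) • A) (w s)) 0 s := by
      intro s hs
      have h3 := hasDerivAt_exp_smul_apply (-A) (hw' s hs.1)
      simp only [smul_neg, ← neg_smul] at h3
      refine h3.congr_deriv ?_
      have : exp ((-s) • A) (A (w s)) = A (exp ((-s) • A) (w s)) := by
        have h4 : Commute A (exp ((-s) • A)) := ((Commute.refl A).smul_right _).exp_right
        exact (congrArg (fun L : E →L[ℝ] E => L (w s)) h4.eq).symm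
      rw [this]
      simp
    have := intervalIntegral.integral_eq_sub_of_hasDerivAt_of_le ht h1 h2 (by simp)
    simp only [intervalIntegral.integral_zero, neg_zero, zero_smul, exp_zero] at this
    exact sub_eq_zero.1 this.symm
  have hexp : ∀ t, 0 ≤ t → w t = exp (t • A) (w 0) := by
    intro t ht
    rw [← hconst t ht, exp_smul_apply_exp_smul_apply, add_neg_cancel, zero_smul, exp_zero]
    rfl
  have hc := hd.const_nonneg
  -- Flowing back from time `t` contracts the unstable component, so boundedness of `w` forces it to
  -- vanish as `t → ∞`.
  have hun : ∀ t, 0 ≤ t → ‖(1 - P) (w 0)‖ ≤ c * Real.exp (-a * t) * M := by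
    intro t ht
    have h1 : (1 - P) (w 0) = (exp ((0 - t) • A) * (1 - P)) (w t) := by
      have h4 : Commute (1 - P) (exp ((-t) • A)) := (Commute.one_left _).sub_left (hd.commute_exp _)
      rw [← hconst t ht, zero_sub, ← h4.eq]
      rfl
    rw [h1]
    refine (hd.norm_unstable_apply_le ht _).trans ?_
    rw [sub_zero]
    gcongr
    exact hM t ht
  have hlim : Tendsto (fun t : ℝ => c * Real.exp (-a * t) * M) atTop (𝓝 (c * 0 * M)) := by
    refine (Tendsto.const_mul c ?_).mul_const M
    refine Real.tendsto_exp_atBot.comp ?_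
    exact tendsto_id.const_mul_atTop_of_neg (neg_lt_zero.2 hd.rate_pos)
  have hzero : (1 - P) (w 0) = 0 := by
    rw [mul_zero, zero_mul] at hlim
    have := ge_of_tendsto hlim (eventually_atTop.2 ⟨0, fun t ht => hun t ht⟩)
    exact norm_le_zero_iff.1 this
  have hP : w 0 = P (w 0) := sub_eq_zero.1 hzero
  rw [hexp t ht]
  exact congrArg _ hP

/-- Bounded solutions of `v' = A v + f` on the half-line, in terms of their stable component at
`0`. -/
theorem eq_exp_smul_apply_add_greenFun (hd : HasExpDichotomy A P a c) {f v : ℝ → E}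
    (hf : Continuous f) {N M : ℝ} (hN : ∀ t, 0 ≤ t → ‖f t‖ ≤ N)
    (hv : ContinuousOn v (Ici 0)) (hv' : ∀ t, 0 < t → HasDerivAt v (A (v t) + f t) t)
    (hM : ∀ t, 0 ≤ t → ‖v t‖ ≤ M) {t : ℝ} (ht : 0 ≤ t) :
    v t = exp (t • A) (P (v 0)) + greenFun A P f t := by
  have hg := hasDerivAt_greenFun A P hf
  have hgc : Continuous (greenFun A P f) := continuous_iff_continuousAt.2 fun t => (hg t).continuousAt
  have hN' : ∀ s, 0 ≤ s → ‖f s‖ ≤ N * Real.exp (-0 * s) := by simpa using hN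
  have key := hd.eq_exp_smul_apply_of_bounded (w := fun t => v t - greenFun A P f t)
    (hv.sub hgc.continuousOn) (fun t ht => ((hv' t ht).sub (hg t)).congr_deriv (by
      rw [map_sub]; abel)) (M := M + 2 * c / (a - 0) * N) (fun t ht => by
      refine (norm_sub_le _ _).trans (add_le_add (hM t ht) ?_)
      simpa using hd.norm_greenFun_le hf le_rfl hd.rate_pos hN' ht) ht
  rw [map_sub, hd.apply_greenFun_zero hf hN, sub_zero] at key
  exact sub_eq_iff_eq_add.1 key

theorem norm_greenFun_le_of_bounded (hd : HasExpDichotomy A P a c) (f : ℝ →ᵇ E) {t : ℝ}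
    (ht : 0 ≤ t) : ‖greenFun A P f t‖ ≤ 2 * c / a * ‖f‖ := by
  simpa using hd.norm_greenFun_le f.continuous le_rfl hd.rate_pos (M := ‖f‖)
    (by simpa using fun s _ => f.norm_coe_le_norm s) ht

theorem integrableOn_greenInit (hd : HasExpDichotomy A P a c) (f : ℝ →ᵇ E) :
    IntegrableOn (fun s => (exp ((-s) • A) * (1 - P)) (f s)) (Ioi 0) := by
  simpa using hd.integrableOn_unstable f.continuous le_rfl (β := 0) (M := ‖f‖)
    (by simpa using fun s _ => f.norm_coe_le_norm s) le_rfl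

theorem greenFun_add (hd : HasExpDichotomy A P a c) (f g : ℝ →ᵇ E) (t : ℝ) :
    greenFun A P (f + g) t = greenFun A P f t + greenFun A P g t := by
  have h1 : greenInit A P (f + g) = greenInit A P f + greenInit A P g := by
    rw [greenInit, greenInit, greenInit,
      ← integral_add (hd.integrableOn_greenInit f) (hd.integrableOn_greenInit g)]
    simp only [Pi.add_apply, map_add]
  have h2 := intervalIntegral.integral_add (μ := volume) (a := 0) (b := t)
    ((continuous_exp_neg_smul_apply A f.continuous).intervalIntegrable _ _)
    ((continuous_exp_neg_smul_apply A g.continuous).intervalIntegrable _ _)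
  rw [greenFun, greenFun, greenFun, h1, ← map_add, sub_add_sub_comm, ← h2]
  simp only [Pi.add_apply, map_add]

/-- The operator `f ↦ greenFun A P f` on bounded functions on the half-line; these are represented
as bounded functions on `ℝ`, the values at negative arguments being irrelevant. -/
noncomputable def greenCLM (hd : HasExpDichotomy A P a c) : (ℝ →ᵇ E) →L[ℝ] (ℝ →ᵇ E) :=
  LinearMap.mkContinuous
    { toFun := fun f => ofNormedAddCommGroup (fun t => greenFun A P f (max t 0))
        ((continuous_iff_continuousAt.2 fun t =>
          (hasDerivAt_greenFun A P f.continuous t).continuousAt).comp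
            (continuous_id.max continuous_const))
        (2 * c / a * ‖f‖) (fun t => hd.norm_greenFun_le_of_bounded f (le_max_right t 0))
      map_add' := fun f g => by ext t; exact hd.greenFun_add f g _
      map_smul' := fun r f => by ext t; exact greenFun_smul A P r f _ }
    (2 * c / a) (fun f => norm_ofNormedAddCommGroup_le _ (by
      have := hd.const_nonneg
      have := hd.rate_pos
      positivity) (fun t => hd.norm_greenFun_le_of_bounded f (le_max_right t 0)))

/-- The stable orbits `t ↦ exp (t A) P b` on the half-line. -/
noncomputable def stableOrbit (hd : HasExpDichotomy A P a c) : E →L[ℝ] (ℝ →ᵇ E) :=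
  LinearMap.mkContinuous
    { toFun := fun b => ofNormedAddCommGroup (fun t => exp ((max t 0) • A) (P b))
        (((continuous_exp_smul A).comp (continuous_id.max continuous_const)).clm_apply
          continuous_const)
        (c * ‖b‖) (fun t => hd.norm_exp_smul_apply_le' (le_max_right t 0) b)
      map_add' := fun b b' => by ext t; simp
      map_smul' := fun r b => by ext t; simp }
    c (fun b => norm_ofNormedAddCommGroup_le _ (by
      have := hd.const_nonneg
      positivity) (fun t => hd.norm_exp_smul_apply_le' (le_max_right t 0) b))

end HasExpDichotomy

end Green

/-! ### Superposition operators on bounded continuous functions. -/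

section Superposition
open BoundedContinuousFunction
open scoped BoundedContinuousFunction

-- `E` and `F` share a universe so that the induction in `contDiff_superposition` may replace `F` by
-- `E →L[ℝ] F`.
universe u
variable {T : Type*} [TopologicalSpace T]
variable {E F : Type u} [NormedAddCommGroup E] [NormedAddCommGroup F]

/-- The superposition operator `u ↦ h ∘ u` of a compactly supported continuous map. -/
noncomputable def superposition (T : Type*) [TopologicalSpace T] {h : E → F} (hc : Continuous h)
    (hs : HasCompactSupport h) (u : T →ᵇ E) : T →ᵇ F :=
  ofNormedAddCommGroup (fun t => h (u t)) (hc.comp u.continuous)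
    (hs.exists_bound_of_continuous hc).choose
    fun t => (hs.exists_bound_of_continuous hc).choose_spec (u t)

@[simp]
theorem superposition_apply {h : E → F} (hc : Continuous h) (hs : HasCompactSupport h)
    (u : T →ᵇ E) (t : T) : superposition T hc hs u t = h (u t) := rfl

theorem continuous_superposition {h : E → F} (hc : Continuous h) (hs : HasCompactSupport h) :
    Continuous (superposition T hc hs) := by
  have huc := hs.uniformContinuous_of_continuous hc
  rw [Metric.uniformContinuous_iff] at huc
  rw [Metric.continuous_iff]
  intro u ε hε
  obtain ⟨δ, hδ, H⟩ := huc (ε / 2) (half_pos hε)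
  refine ⟨δ, hδ, fun v hv => ?_⟩
  refine lt_of_le_of_lt ?_ (half_lt_self hε)
  rw [dist_le (half_pos hε).le]
  exact fun t => (H ((dist_coe_le_dist t).trans_lt hv)).le

variable [NormedSpace ℝ E] [NormedSpace ℝ F]

/-- Pointwise evaluation of operator-valued bounded functions on bounded functions. -/
noncomputable def pointwiseApply (T : Type*) [TopologicalSpace T] (E F : Type*)
    [NormedAddCommGroup E] [NormedSpace ℝ E] [NormedAddCommGroup F] [NormedSpace ℝ F] :
    (T →ᵇ (E →L[ℝ] F)) →L[ℝ] (T →ᵇ E) →L[ℝ] (T →ᵇ F) :=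
  LinearMap.mkContinuous₂
    (LinearMap.mk₂ ℝ (fun (L : T →ᵇ (E →L[ℝ] F)) (u : T →ᵇ E) => ofNormedAddCommGroup (fun t => L t (u t))
        (L.continuous.clm_apply u.continuous) (‖L‖ * ‖u‖)
        (fun t => (L t).le_of_opNorm_le_of_le (L.norm_coe_le_norm t) (u.norm_coe_le_norm t)))
      (fun _ _ _ => rfl) (fun _ _ _ => rfl)
      (fun L u v => by ext t; exact map_add (L t) (u t) (v t))
      (fun c L u => by ext t; exact map_smul (L t) c (u t)))
    1 (fun L u => by
      rw [one_mul]
      exact norm_ofNormedAddCommGroup_le _ (by positivity)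
        (fun t => (L t).le_of_opNorm_le_of_le (L.norm_coe_le_norm t) (u.norm_coe_le_norm t)))

@[simp]
theorem pointwiseApply_apply (L : T →ᵇ (E →L[ℝ] F)) (u : T →ᵇ E) (t : T) :
    pointwiseApply T E F L u t = L t (u t) := rfl

/-- The mean value inequality is used along the segment from `u t` to `u t + v t`. The bound is
uniform in `t` because superposition with `fderiv ℝ h` is continuous in the sup norm, `h` having
compact support. -/
theorem hasFDerivAt_superposition {h : E → F} (hh : ContDiff ℝ 1 h) (hs : HasCompactSupport h)
    (u : T →ᵇ E) :
    HasFDerivAt (superposition T hh.continuous hs)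
      (pointwiseApply T E F
        (superposition T (hh.continuous_fderiv one_ne_zero) (hs.fderiv ℝ) u)) u := by
  have hcont := continuous_superposition (T := T) (hh.continuous_fderiv one_ne_zero) (hs.fderiv ℝ)
  rw [hasFDerivAt_iff_isLittleO_nhds_zero, Asymptotics.isLittleO_iff]
  intro ε hε
  obtain ⟨δ, hδ, H⟩ := Metric.continuous_iff.1 hcont u ε hε
  filter_upwards [Metric.ball_mem_nhds 0 hδ] with v hv
  rw [mem_ball_zero_iff] at hv
  rw [norm_le (by positivity)]
  intro t
  have key := (convex_segment (u t) (u t + v t)).norm_image_sub_le_of_norm_hasFDerivWithin_le'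
    (f := h) (f' := fderiv ℝ h) (φ := fderiv ℝ h (u t)) (C := ε)
    (x := u t) (y := u t + v t)
    (fun x _ => ((hh.differentiable one_ne_zero) x).hasFDerivAt.hasFDerivWithinAt) ?_
    (left_mem_segment ℝ _ _) (right_mem_segment ℝ _ _)
  · rw [add_sub_cancel_left] at key
    refine key.trans ?_
    exact mul_le_mul_of_nonneg_left (v.norm_coe_le_norm t) hε.le
  · intro x hx
    rw [segment_eq_image'] at hx
    obtain ⟨θ, hθ, rfl⟩ := hx
    have h1 : dist (u + θ • v) u < δ := by
      rw [dist_eq_norm, add_sub_cancel_left, norm_smul, Real.norm_of_nonneg hθ.1]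
      exact (mul_le_of_le_one_left (norm_nonneg _) hθ.2).trans_lt hv
    have h2 := (dist_coe_le_dist t).trans (H _ h1).le
    rw [dist_eq_norm] at h2
    simpa using h2

theorem contDiff_superposition (n : ℕ) {F : Type u} [NormedAddCommGroup F] [NormedSpace ℝ F]
    {h : E → F} (hh : ContDiff ℝ n h) (hc : Continuous h) (hs : HasCompactSupport h) :
    ContDiff ℝ n (superposition T hc hs) := by
  induction n generalizing F with
  | zero =>
    rw [Nat.cast_zero, contDiff_zero]
    exact continuous_superposition _ _
  | succ n ih =>
    have h1 : ContDiff ℝ 1 h := hh.of_le (by norm_cast; omega)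
    have h2 : ContDiff ℝ n (fderiv ℝ h) := hh.fderiv_right (by norm_cast)
    rw [Nat.cast_add, Nat.cast_one, contDiff_succ_iff_hasFDerivAt]
    have h3 := (pointwiseApply T E F).contDiff.comp
      (ih h2 (hh.continuous_fderiv (by simp)) (hs.fderiv ℝ))
    exact ⟨_, h3, fun u => hasFDerivAt_superposition h1 hs u⟩

end Superposition

/-! ### Smooth dependence of fixed points on parameters. -/

section UniformContraction

variable {Λ X : Type*} [NormedAddCommGroup Λ] [NormedSpace ℝ Λ] [CompleteSpace Λ]
  [NormedAddCommGroup X] [NormedSpace ℝ X] [CompleteSpace X]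

/-- Fixed points of a `C^n` family of uniform contractions depend on the parameter in a `C^n`
way. -/
theorem contDiffAt_fixedPoint {n : WithTop ℕ∞} (hn : n ≠ 0) {S : Λ × X → X} {x : Λ → X} {p₀ : Λ}
    {c : ℝ} (hc0 : 0 ≤ c) (hc : c < 1) (hS : ContDiffAt ℝ n S (p₀, x p₀))
    (hlip : ∀ᶠ p in 𝓝 p₀, ∀ u v, ‖S (p, u) - S (p, v)‖ ≤ c * ‖u - v‖)
    (hfix : ∀ᶠ p in 𝓝 p₀, S (p, x p) = x p) :
    ContDiffAt ℝ n x p₀ := by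
  set f : Λ × X → X := fun w => w.2 - S w with hf
  have hcd : ContDiffAt ℝ n f (p₀, x p₀) := contDiffAt_snd.sub hS
  have hSd : DifferentiableAt ℝ S (p₀, x p₀) := hS.differentiableAt hn
  -- The partial derivative of `S` in the second variable has norm at most `c < 1`, so the Neumann
  -- series inverts `1` minus it and the implicit function theorem applies.
  have hinv : (fderiv ℝ f (p₀, x p₀) ∘L .inr ℝ Λ X).IsInvertible := by
    have h1 : fderiv ℝ f (p₀, x p₀) ∘L .inr ℝ Λ X =
        1 - fderiv ℝ S (p₀, x p₀) ∘L .inr ℝ Λ X := by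
      rw [hf, fderiv_fun_sub differentiableAt_snd hSd, fderiv_snd]
      ext v
      simp
    have h2 : ‖fderiv ℝ S (p₀, x p₀) ∘L .inr ℝ Λ X‖ < 1 := by
      refine lt_of_le_of_lt ?_ hc
      have h3 : HasFDerivAt (fun u => S (p₀, u)) (fderiv ℝ S (p₀, x p₀) ∘L .inr ℝ Λ X) (x p₀) :=
        hSd.hasFDerivAt.comp (x p₀) (hasFDerivAt_prodMk_right p₀ (x p₀))
      refine h3.le_of_lip' hc0 (Eventually.of_forall fun u => ?_)
      exact hlip.self_of_nhds u (x p₀)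
    rw [h1]
    obtain ⟨U, hU⟩ := isUnit_one_sub_of_norm_lt_one h2
    rw [← hU]
    exact ⟨ContinuousLinearEquiv.unitsEquiv ℝ X U, rfl⟩
  have hψ := hcd.contDiffAt_implicitFunction hn hinv
  refine hψ.congr_of_eventuallyEq ?_
  filter_upwards [hcd.eventually_apply_implicitFunction hn hinv, hlip, hfix] with p hp hl hx
  have h0 : f (p₀, x p₀) = 0 := sub_eq_zero.2 hfix.self_of_nhds.symm
  -- Both `w` and `x p` are fixed points of the same contraction, hence equal; no prior continuity
  -- of `x` is needed.
  set w := hcd.implicitFunction hn hinv p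
  have hp : w = S (p, w) := sub_eq_zero.1 (hp.trans h0)
  have h4 := hl (x p) w
  change w = S (p, w) at hp
  rw [hx, ← hp] at h4
  have h5 : ‖x p - w‖ = 0 := by
    have := norm_nonneg (x p - w)
    nlinarith
  exact sub_eq_zero.1 (norm_eq_zero.1 h5)

end UniformContraction

/-! ### The curve `δ exp (-μ t)` as a smooth function of `μ`. -/

section DecayCurve
open NormedSpace BoundedContinuousFunction
open scoped BoundedContinuousFunction

/-- The function `t ↦ δ exp (-μ t)` on the half-line. -/
noncomputable def decayCurve (δ μ : ℝ) : ℝ →ᵇ ℝ :=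
  ofNormedAddCommGroup (fun t => δ * Real.exp (-(max μ 0 * max t 0))) (by fun_prop) |δ| (fun t => by
    rw [norm_mul, Real.norm_eq_abs, Real.norm_eq_abs, Real.abs_exp]
    refine mul_le_of_le_one_right (abs_nonneg _) (Real.exp_le_one_iff.2 ?_)
    have := mul_nonneg (le_max_right μ 0) (le_max_right t 0)
    linarith)

theorem decayCurve_apply (δ μ t : ℝ) :
    decayCurve δ μ t = δ * Real.exp (-(max μ 0 * max t 0)) := rfl

theorem abs_decayCurve_le {δ : ℝ} (hδ : 0 ≤ δ) (μ t : ℝ) : |decayCurve δ μ t| ≤ δ := by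
  rw [decayCurve_apply, abs_mul, Real.abs_exp, abs_of_nonneg hδ]
  refine mul_le_of_le_one_right hδ (Real.exp_le_one_iff.2 ?_)
  have := mul_nonneg (le_max_right μ 0) (le_max_right t 0)
  linarith

theorem decayCurve_of_nonneg (δ : ℝ) {μ t : ℝ} (hμ : 0 ≤ μ) (ht : 0 ≤ t) :
    decayCurve δ μ t = δ * Real.exp (-(μ * t)) := by
  rw [decayCurve_apply, max_eq_left hμ, max_eq_left ht]

theorem exp_smul_neg_one_real (t : ℝ) :
    exp (t • (-1 : ℝ →L[ℝ] ℝ)) = Real.exp (-t) • (1 : ℝ →L[ℝ] ℝ) := by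
  have h : t • (-1 : ℝ →L[ℝ] ℝ) = algebraMap ℝ _ (-t) := by
    rw [Algebra.algebraMap_eq_smul_one]; simp
  rw [h, ← algebraMap_exp_comm, Algebra.algebraMap_eq_smul_one, Real.exp_eq_exp_ℝ]

theorem hasExpDichotomy_neg_one_real : HasExpDichotomy (-1 : ℝ →L[ℝ] ℝ) 1 1 1 where
  rate_pos := one_pos
  const_nonneg := zero_le_one
  comm := Commute.one_left _
  idem := one_mul _
  stable t _ := by
    rw [exp_smul_neg_one_real, mul_one, norm_smul, norm_one, Real.norm_eq_abs, Real.abs_exp]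
    simp
  unstable t _ := by simp [Real.exp_nonneg]

/-- Rather than differentiating in `μ` uniformly in `t`, write the equation as `v' = -v + (1 - μ)
v`: the curve is then the fixed point of an affine map, contracting for `μ` near `1`, built from the
Green operator of the scalar dichotomy `A = -1`, `P = 1`. -/
theorem contDiffAt_decayCurve (δ : ℝ) {n : WithTop ℕ∞} (hn : n ≠ 0) :
    ContDiffAt ℝ n (decayCurve δ) 1 := by
  set K := hasExpDichotomy_neg_one_real.greenCLM
  refine contDiffAt_fixedPoint (c := 1 / 2) hn (by norm_num) (by norm_num)
    (S := fun w : ℝ × (ℝ →ᵇ ℝ) => decayCurve δ 1 + K ((1 - w.1) • w.2)) ?_ ?_ ?_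
  · refine ContDiff.contDiffAt ?_
    fun_prop
  · have hlim : Tendsto (fun μ : ℝ => ‖K‖ * |1 - μ|) (𝓝 1) (𝓝 (‖K‖ * |1 - 1|)) := by
      apply Continuous.tendsto
      fun_prop
    rw [sub_self, abs_zero, mul_zero] at hlim
    filter_upwards [hlim.eventually (gt_mem_nhds (show (0 : ℝ) < 1 / 2 by norm_num))] with μ hμ u v
    rw [add_sub_add_left_eq_sub, ← map_sub, ← smul_sub]
    calc _ ≤ ‖K‖ * (|1 - μ| * ‖u - v‖) := by
          refine (K.le_opNorm _).trans ?_
          rw [norm_smul, Real.norm_eq_abs]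
      _ = ‖K‖ * |1 - μ| * ‖u - v‖ := by ring
      _ ≤ _ := by gcongr
  · filter_upwards [lt_mem_nhds one_pos] with μ hμ
    ext t
    have hd : ∀ t, 0 < t → HasDerivAt (decayCurve δ μ)
        ((-1 : ℝ →L[ℝ] ℝ) (decayCurve δ μ t) + ((1 - μ) • decayCurve δ μ) t) t := by
      intro t ht
      have h0 : HasDerivAt (fun t : ℝ => -(μ * t)) (-μ) t := by
        simpa using (hasDerivAt_id t).const_mul (-μ)
      have h1 : (fun t => δ * Real.exp (-(μ * t))) =ᶠ[𝓝 t] decayCurve δ μ := by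
        filter_upwards [lt_mem_nhds ht] with s hs
        rw [decayCurve_of_nonneg δ hμ.le hs.le]
      refine ((h0.exp.const_mul δ).congr_of_eventuallyEq h1.symm).congr_deriv ?_
      rw [BoundedContinuousFunction.smul_apply, decayCurve_of_nonneg δ hμ.le ht.le]
      simp
      ring
    have key := hasExpDichotomy_neg_one_real.eq_exp_smul_apply_add_greenFun
      ((1 - μ) • decayCurve δ μ).continuous (fun t _ => norm_coe_le_norm _ t)
      (decayCurve δ μ).continuous.continuousOn hd (fun t _ => norm_coe_le_norm _ t)
      (le_max_right t 0)
    have e1 : decayCurve δ μ t = decayCurve δ μ (max t 0) := by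
      simp [decayCurve_apply]
    rw [e1, key, BoundedContinuousFunction.add_apply, exp_smul_neg_one_real]
    congr 1
    simp [decayCurve_apply, mul_comm]

end DecayCurve

/-! ### The nonlinear forcing term as a smooth operator. -/

section Forcing
open NormedSpace BoundedContinuousFunction
open scoped BoundedContinuousFunction

variable {E : Type*} [NormedAddCommGroup E] [NormedSpace ℝ E]

/-- The pair of two bounded continuous functions. -/
noncomputable def pairCLM (E : Type*) [NormedAddCommGroup E] [NormedSpace ℝ E] :
    ((ℝ →ᵇ ℝ) × (ℝ →ᵇ E)) →L[ℝ] (ℝ →ᵇ ℝ × E) :=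
  ((ContinuousLinearMap.inl ℝ ℝ E).compLeftContinuousBounded ℝ).comp
      (ContinuousLinearMap.fst ℝ _ _) +
    ((ContinuousLinearMap.inr ℝ ℝ E).compLeftContinuousBounded ℝ).comp
      (ContinuousLinearMap.snd ℝ _ _)

theorem pairCLM_apply (w : (ℝ →ᵇ ℝ) × (ℝ →ᵇ E)) (t : ℝ) : pairCLM E w t = (w.1 t, w.2 t) := by
  simp [pairCLM]

theorem Continuous.fst_smul_self {g : ℝ × E → E} (hg : Continuous g) :
    Continuous fun w : ℝ × E => w.1 • g w := continuous_fst.smul hg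

theorem HasCompactSupport.fst_smul_self {g : ℝ × E → E} (hg : HasCompactSupport g) :
    HasCompactSupport fun w : ℝ × E => w.1 • g w := HasCompactSupport.smul_left hg

/-- The operator `(ζ, u) ↦ ζ g(ζ, u)` on bounded functions. -/
noncomputable def singularForcing {g : ℝ × E → E} (hg : Continuous g) (hs : HasCompactSupport g)
    (w : (ℝ →ᵇ ℝ) × (ℝ →ᵇ E)) : ℝ →ᵇ E :=
  superposition ℝ hg.fst_smul_self hs.fst_smul_self (pairCLM E w)

theorem singularForcing_apply {g : ℝ × E → E} (hg : Continuous g) (hs : HasCompactSupport g)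
    (w : (ℝ →ᵇ ℝ) × (ℝ →ᵇ E)) (t : ℝ) :
    singularForcing hg hs w t = w.1 t • g (w.1 t, w.2 t) := by
  rw [singularForcing, superposition_apply, pairCLM_apply]

theorem contDiff_singularForcing {g : ℝ × E → E} {k : ℕ} (hgk : ContDiff ℝ k g)
    (hg : Continuous g) (hs : HasCompactSupport g) :
    ContDiff ℝ k (singularForcing hg hs) :=
  (contDiff_superposition k (contDiff_fst.smul hgk) hg.fst_smul_self hs.fst_smul_self).comp
    (pairCLM E).contDiff

theorem norm_singularForcing_sub_le {g : ℝ × E → E} (hg : Continuous g) (hs : HasCompactSupport g)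
    {L δ : ℝ} (hL : ∀ z y y', ‖g (z, y) - g (z, y')‖ ≤ L * ‖y - y'‖) (hL0 : 0 ≤ L) (hδ : 0 ≤ δ)
    {ζ : ℝ →ᵇ ℝ} (hζ : ∀ t, |ζ t| ≤ δ) (u v : ℝ →ᵇ E) :
    ‖singularForcing hg hs (ζ, u) - singularForcing hg hs (ζ, v)‖ ≤ δ * L * ‖u - v‖ := by
  rw [norm_le (by positivity)]
  intro t
  rw [BoundedContinuousFunction.sub_apply, singularForcing_apply, singularForcing_apply, ← smul_sub,
    norm_smul, mul_assoc]
  refine mul_le_mul (hζ t) ((hL _ _ _).trans ?_) (norm_nonneg _) hδ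
  exact mul_le_mul_of_nonneg_left ((u - v).norm_coe_le_norm t) hL0

end Forcing

/-! ### Bounded orbits as fixed points: existence, smoothness, separation. -/

section Orbits
open NormedSpace BoundedContinuousFunction
open scoped BoundedContinuousFunction

namespace HasExpDichotomy

variable {E : Type*} [NormedAddCommGroup E] [NormedSpace ℝ E] [CompleteSpace E]
  {A P : E →L[ℝ] E} {a c : ℝ} {g : ℝ × E → E}

/-- The fixed points of `u ↦ orbitMap δ ((μ, b), u)` are the bounded solutions of
`u' = μ (A u - ζ g(ζ, u))`, `ζ = δ exp (-μ t)`, on the half-line with `P (u 0) = P b`. -/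
noncomputable def orbitMap (hd : HasExpDichotomy A P a c) (hg : Continuous g)
    (hs : HasCompactSupport g) (δ : ℝ) (w : (ℝ × E) × (ℝ →ᵇ E)) : ℝ →ᵇ E :=
  hd.stableOrbit w.1.2 + hd.greenCLM ((w.1.1 - 1) • A.compLeftContinuousBounded ℝ w.2 -
    w.1.1 • singularForcing hg hs (decayCurve δ w.1.1, w.2))

theorem contDiffAt_orbitMap (hd : HasExpDichotomy A P a c) {k : ℕ} (hk : k ≠ 0)
    (hgk : ContDiff ℝ k g) (hg : Continuous g) (hs : HasCompactSupport g) (δ : ℝ) (b : E)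
    (u : ℝ →ᵇ E) : ContDiffAt ℝ k (hd.orbitMap hg hs δ) ((1, b), u) := by
  have h1 : ContDiffAt ℝ k (fun w : (ℝ × E) × (ℝ →ᵇ E) => decayCurve δ w.1.1) ((1, b), u) :=
    ContDiffAt.comp (g := decayCurve δ) ((1, b), u)
      (contDiffAt_decayCurve δ (by exact_mod_cast hk)) (by fun_prop)
  have h2 : ContDiffAt ℝ k (fun w : (ℝ × E) × (ℝ →ᵇ E) =>
      singularForcing hg hs (decayCurve δ w.1.1, w.2)) ((1, b), u) :=
    (contDiff_singularForcing hgk hg hs).contDiffAt.comp _ (h1.prodMk contDiffAt_snd)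
  unfold orbitMap
  fun_prop

theorem norm_orbitMap_sub_le (hd : HasExpDichotomy A P a c) (hg : Continuous g)
    (hs : HasCompactSupport g) {L δ : ℝ}
    (hL : ∀ z y y', ‖g (z, y) - g (z, y')‖ ≤ L * ‖y - y'‖) (hL0 : 0 ≤ L) (hδ : 0 ≤ δ)
    (μ : ℝ) (b : E) (u v : ℝ →ᵇ E) :
    ‖hd.orbitMap hg hs δ ((μ, b), u) - hd.orbitMap hg hs δ ((μ, b), v)‖ ≤
      ‖hd.greenCLM‖ * (|μ - 1| * ‖(A.compLeftContinuousBounded ℝ : (ℝ →ᵇ E) →L[ℝ] (ℝ →ᵇ E))‖ + |μ| * (δ * L)) *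
        ‖u - v‖ := by
  have h : hd.orbitMap hg hs δ ((μ, b), u) - hd.orbitMap hg hs δ ((μ, b), v) =
      hd.greenCLM ((μ - 1) • A.compLeftContinuousBounded ℝ (u - v) -
        μ • (singularForcing hg hs (decayCurve δ μ, u) -
          singularForcing hg hs (decayCurve δ μ, v))) := by
    simp only [orbitMap, map_sub, smul_sub, map_smul]
    abel
  rw [h, mul_assoc]
  refine (ContinuousLinearMap.le_opNorm _ _).trans ?_
  gcongr
  refine (norm_sub_le _ _).trans ?_
  rw [add_mul, norm_smul, norm_smul, Real.norm_eq_abs, Real.norm_eq_abs, mul_assoc, mul_assoc]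
  gcongr
  · exact ContinuousLinearMap.le_opNorm _ _
  · exact norm_singularForcing_sub_le hg hs hL hL0 hδ (abs_decayCurve_le hδ μ) u v

/-- The equation with speed `μ` is read as `u' = A u + f`, moving `(μ - 1) A u` into `f`. The linear
part, and so the Green operator, does not depend on `μ`. -/
theorem orbitMap_eq_self (hd : HasExpDichotomy A P a c) (hg : Continuous g)
    (hs : HasCompactSupport g) {δ μ : ℝ} {b : E} {u : ℝ →ᵇ E}
    (hu : ∀ t, 0 < t → HasDerivAt u (μ • (A (u t) -
      decayCurve δ μ t • g (decayCurve δ μ t, u t))) t)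
    (hclip : ∀ t, u t = u (max t 0)) (hb : P (u 0) = P b) :
    hd.orbitMap hg hs δ ((μ, b), u) = u := by
  ext t
  set f := (μ - 1) • A.compLeftContinuousBounded ℝ u -
    μ • singularForcing hg hs (decayCurve δ μ, u) with hf
  have key := hd.eq_exp_smul_apply_add_greenFun f.continuous (fun t _ => norm_coe_le_norm f t)
    u.continuous.continuousOn (fun t ht => (hu t ht).congr_deriv (by
      simp only [hf, BoundedContinuousFunction.sub_apply, BoundedContinuousFunction.smul_apply,
        singularForcing_apply, ContinuousLinearMap.compLeftContinuousBounded_apply, smul_sub,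
        sub_smul, one_smul]
      abel)) (fun t _ => norm_coe_le_norm u t) (le_max_right t 0)
  rw [hclip t, key, hb]
  rfl

theorem eq_of_orbitMap_eq_self (hd : HasExpDichotomy A P a c) (hg : Continuous g)
    (hs : HasCompactSupport g) {δ : ℝ} {b : E} {u : ℝ →ᵇ E}
    (hu : hd.orbitMap hg hs δ ((1, b), u) = u) (t : ℝ) :
    u t = exp ((max t 0) • A) (P b) +
      greenFun A P (-singularForcing hg hs (decayCurve δ 1, u) : ℝ →ᵇ E) (max t 0) := by
  conv_lhs => rw [← hu]
  simp only [orbitMap, sub_self, zero_smul, zero_sub, one_smul]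
  rfl

theorem hasDerivAt_of_orbitMap_eq_self (hd : HasExpDichotomy A P a c) (hg : Continuous g)
    (hs : HasCompactSupport g) {δ : ℝ} {b : E} {u : ℝ →ᵇ E}
    (hu : hd.orbitMap hg hs δ ((1, b), u) = u) {t : ℝ} (ht : 0 < t) :
    HasDerivAt u (A (u t) - decayCurve δ 1 t • g (decayCurve δ 1 t, u t)) t := by
  have h := hd.eq_of_orbitMap_eq_self hg hs hu
  set f := -singularForcing hg hs (decayCurve δ 1, u) with hf
  have h1 : (fun t => exp (t • A) (P b) + greenFun A P f t) =ᶠ[𝓝 t] u := by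
    filter_upwards [lt_mem_nhds ht] with s hs
    rw [h s, max_eq_left hs.le]
  refine (((hasDerivAt_exp_smul_apply A (hasDerivAt_const t (P b))).add
    (hasDerivAt_greenFun A P f.continuous t)).congr_of_eventuallyEq h1.symm).congr_deriv ?_
  have hft : f t = -(decayCurve δ 1 t • g (decayCurve δ 1 t, u t)) := by
    rw [hf, BoundedContinuousFunction.coe_neg, Pi.neg_apply, singularForcing_apply]
  have hut := h t
  rw [max_eq_left ht.le] at hut
  rw [map_zero, add_zero, ← add_assoc, ← map_add, ← hut, hft, ← sub_eq_add_neg]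

theorem apply_zero_of_orbitMap_eq_self (hd : HasExpDichotomy A P a c) (hg : Continuous g)
    (hs : HasCompactSupport g) {δ : ℝ} {b : E} {u : ℝ →ᵇ E}
    (hu : hd.orbitMap hg hs δ ((1, b), u) = u) : P (u 0) = P b := by
  set f := -singularForcing hg hs (decayCurve δ 1, u) with hf
  rw [hd.eq_of_orbitMap_eq_self hg hs hu 0, max_self, map_add,
    hd.apply_greenFun_zero f.continuous (fun t _ => norm_coe_le_norm f t), zero_smul, exp_zero,
    add_zero]
  exact congrArg (fun Q : E →L[ℝ] E => Q b) hd.idem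

theorem clip_of_orbitMap_eq_self (hd : HasExpDichotomy A P a c) (hg : Continuous g)
    (hs : HasCompactSupport g) {δ : ℝ} {b : E} {u : ℝ →ᵇ E}
    (hu : hd.orbitMap hg hs δ ((1, b), u) = u) (t : ℝ) : u t = u (max t 0) := by
  rw [hd.eq_of_orbitMap_eq_self hg hs hu t, hd.eq_of_orbitMap_eq_self hg hs hu (max t 0)]
  simp

/-- The factor `ζ = δ exp (-t)` makes the forcing decay at rate `1`, whence the restriction `β ≤ 1`
besides `β < a`. -/
theorem norm_le_of_orbitMap_eq_self (hd : HasExpDichotomy A P a c) (hg : Continuous g)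
    (hs : HasCompactSupport g) {M δ : ℝ} (hM : ∀ w, ‖g w‖ ≤ M) (hδ : 0 ≤ δ) {b : E} {u : ℝ →ᵇ E}
    (hu : hd.orbitMap hg hs δ ((1, b), u) = u) {β : ℝ} (hβ : 0 ≤ β) (hβa : β < a) (hβ1 : β ≤ 1)
    {t : ℝ} (ht : 0 ≤ t) :
    ‖u t‖ ≤ (c * ‖b‖ + 2 * c / (a - β) * (δ * M)) * Real.exp (-β * t) := by
  have hM0 : 0 ≤ M := (norm_nonneg _).trans (hM 0)
  have hc := hd.const_nonneg
  set f := -singularForcing hg hs (decayCurve δ 1, u) with hf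
  have hfb : ∀ s, 0 ≤ s → ‖f s‖ ≤ δ * M * Real.exp (-β * s) := by
    intro s hs0
    rw [hf, BoundedContinuousFunction.coe_neg, Pi.neg_apply, norm_neg, singularForcing_apply,
      norm_smul, Real.norm_eq_abs, decayCurve_of_nonneg δ zero_le_one hs0, abs_mul, Real.abs_exp,
      abs_of_nonneg hδ, one_mul]
    have : Real.exp (-s) ≤ Real.exp (-β * s) := Real.exp_le_exp.2 (by nlinarith)
    calc _ ≤ δ * Real.exp (-β * s) * M := by gcongr; exact hM _
      _ = _ := by ring
  rw [hd.eq_of_orbitMap_eq_self hg hs hu t, max_eq_left ht]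
  refine (norm_add_le _ _).trans ?_
  rw [add_mul]
  refine add_le_add ?_ (hd.norm_greenFun_le f.continuous hβ hβa hfb ht)
  refine (hd.norm_exp_smul_apply_le ht b).trans ?_
  have : Real.exp (-a * t) ≤ Real.exp (-β * t) := Real.exp_le_exp.2 (by nlinarith)
  calc _ ≤ c * Real.exp (-β * t) * ‖b‖ := by gcongr
    _ = _ := by ring

theorem tendsto_zero_of_orbitMap_eq_self (hd : HasExpDichotomy A P a c) (hg : Continuous g)
    (hs : HasCompactSupport g) {δ : ℝ} (hδ : 0 ≤ δ) {b : E} {u : ℝ →ᵇ E}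
    (hu : hd.orbitMap hg hs δ ((1, b), u) = u) : Tendsto u atTop (𝓝 0) := by
  obtain ⟨M, hM⟩ := hs.exists_bound_of_continuous hg
  have ha := hd.rate_pos
  set β := min 1 (a / 2) with hβ
  have hβ0 : 0 < β := by positivity
  have hβa : β < a := (min_le_right _ _).trans_lt (half_lt_self ha)
  refine squeeze_zero_norm' (eventually_atTop.2 ⟨0, fun t ht =>
    hd.norm_le_of_orbitMap_eq_self hg hs hM hδ hu hβ0.le hβa (min_le_left _ _) ht⟩) ?_
  rw [← mul_zero (c * ‖b‖ + 2 * c / (a - β) * (δ * M))]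
  refine Tendsto.const_mul _ (Real.tendsto_exp_atBot.comp ?_)
  exact tendsto_id.const_mul_atTop_of_neg (neg_lt_zero.2 hβ0)

theorem unique_of_orbitMap_eq_self (hd : HasExpDichotomy A P a c) (hg : Continuous g)
    (hs : HasCompactSupport g) {L δ : ℝ}
    (hL : ∀ z y y', ‖g (z, y) - g (z, y')‖ ≤ L * ‖y - y'‖) (hL0 : 0 ≤ L) (hδ : 0 ≤ δ)
    (hcon : ‖hd.greenCLM‖ * (δ * L) ≤ 1 / 2) {b : E} {u v : ℝ →ᵇ E}
    (hu : hd.orbitMap hg hs δ ((1, b), u) = u) (hv : hd.orbitMap hg hs δ ((1, b), v) = v) :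
    u = v := by
  have h := hd.norm_orbitMap_sub_le hg hs hL hL0 hδ 1 b u v
  rw [hu, hv, sub_self, abs_zero, zero_mul, abs_one, zero_add, one_mul] at h
  have h1 := norm_nonneg (u - v)
  exact sub_eq_zero.1 (norm_eq_zero.1 (by nlinarith))

theorem exists_orbitMap_eq_self (hd : HasExpDichotomy A P a c) (hg : Continuous g)
    (hs : HasCompactSupport g) {L δ : ℝ}
    (hL : ∀ z y y', ‖g (z, y) - g (z, y')‖ ≤ L * ‖y - y'‖) (hL0 : 0 ≤ L) (hδ : 0 ≤ δ)
    (hcon : ‖hd.greenCLM‖ * (δ * L) ≤ 1 / 2) (b : E) :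
    ∃ u : ℝ →ᵇ E, hd.orbitMap hg hs δ ((1, b), u) = u := by
  have hc : ContractingWith (1 / 2) fun u => hd.orbitMap hg hs δ ((1, b), u) := by
    refine ⟨by norm_num [NNReal.half_lt_self], LipschitzWith.of_dist_le_mul fun u v => ?_⟩
    have h := hd.norm_orbitMap_sub_le hg hs hL hL0 hδ 1 b u v
    rw [sub_self, abs_zero, zero_mul, abs_one, zero_add, one_mul] at h
    rw [dist_eq_norm, dist_eq_norm]
    refine h.trans ?_
    push_cast
    gcongr
  exact ⟨_, hc.fixedPoint_isFixedPt⟩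

/-- The bounded orbits depend in a `C^k` way on the parameter and on time, jointly. -/
theorem contDiffAt_orbit (hd : HasExpDichotomy A P a c) {k : ℕ} (hk : k ≠ 0)
    (hgk : ContDiff ℝ k g) (hg : Continuous g) (hs : HasCompactSupport g) {L δ : ℝ}
    (hL : ∀ z y y', ‖g (z, y) - g (z, y')‖ ≤ L * ‖y - y'‖) (hL0 : 0 ≤ L) (hδ : 0 ≤ δ)
    (hcon : ‖hd.greenCLM‖ * (δ * L) ≤ 1 / 2) {U : E → ℝ →ᵇ E}
    (hU : ∀ b, hd.orbitMap hg hs δ ((1, b), U b) = U b) (b₀ : E) {t₀ : ℝ} (ht₀ : 0 < t₀) :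
    ContDiffAt ℝ k (fun p : E × ℝ => U p.1 p.2) (b₀, t₀) := by
  -- Orbits run at speed `μ`. These turn differentiation in time into differentiation in a
  -- parameter.
  set W : ℝ × E → (ℝ →ᵇ E) := fun p => (U p.2).compContinuous ⟨fun t => p.1 * t, by fun_prop⟩ with hW
  have hW1 : W (1, b₀) = U b₀ := by
    ext t; simp [hW]
  have hWfix : ∀ᶠ p in 𝓝 ((1 : ℝ), b₀), hd.orbitMap hg hs δ (p, W p) = W p := by
    filter_upwards [(continuous_fst.tendsto ((1 : ℝ), b₀)).eventually (lt_mem_nhds one_pos)]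
      with ⟨μ, b⟩ hμ
    have hμ : 0 < μ := hμ
    refine hd.orbitMap_eq_self hg hs (fun t ht => ?_) (fun t => ?_) ?_
    · have h1 := hd.hasDerivAt_of_orbitMap_eq_self hg hs (hU b) (mul_pos hμ ht)
      have h2 : HasDerivAt (fun t : ℝ => μ * t) μ t := by
        simpa using (hasDerivAt_id t).const_mul μ
      refine (h1.scomp t h2).congr_deriv ?_
      have h3 : decayCurve δ 1 (μ * t) = decayCurve δ μ t := by
        rw [decayCurve_of_nonneg δ zero_le_one (mul_pos hμ ht).le,
          decayCurve_of_nonneg δ hμ.le ht.le, one_mul]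
      rw [h3]
      rfl
    · change U b (μ * t) = U b (μ * max t 0)
      rw [hd.clip_of_orbitMap_eq_self hg hs (hU b), mul_max_of_nonneg _ _ hμ.le, mul_zero]
    · change P (U b (μ * 0)) = P b
      rw [mul_zero, hd.apply_zero_of_orbitMap_eq_self hg hs (hU b)]
  -- The contraction constant is at most `1 / 2` at `μ = 1`; the slack up to `3 / 4` absorbs the
  -- term `|μ - 1| * N` for `μ` close to `1`.
  have hlip : ∀ᶠ p in 𝓝 ((1 : ℝ), b₀), ∀ u v,
      ‖hd.orbitMap hg hs δ (p, u) - hd.orbitMap hg hs δ (p, v)‖ ≤ 3 / 4 * ‖u - v‖ := by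
    set N := ‖(A.compLeftContinuousBounded ℝ : (ℝ →ᵇ E) →L[ℝ] (ℝ →ᵇ E))‖
    have hlim : Tendsto (fun p : ℝ × E => ‖hd.greenCLM‖ * (|p.1 - 1| * N + |p.1| * (δ * L)))
        (𝓝 (1, b₀)) (𝓝 (‖hd.greenCLM‖ * (|(1 : ℝ) - 1| * N + |(1 : ℝ)| * (δ * L)))) := by
      have hcont : Continuous fun p : ℝ × E =>
        ‖hd.greenCLM‖ * (|p.1 - 1| * N + |p.1| * (δ * L)) := by fun_prop
      exact hcont.tendsto (1, b₀)
    rw [sub_self, abs_zero, zero_mul, zero_add, abs_one, one_mul] at hlim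
    filter_upwards [hlim.eventually (gt_mem_nhds (show _ < (3 / 4 : ℝ) by linarith))]
      with ⟨μ, b⟩ hμ u v
    refine (hd.norm_orbitMap_sub_le hg hs hL hL0 hδ μ b u v).trans ?_
    exact mul_le_mul_of_nonneg_right (le_of_lt hμ) (norm_nonneg _)
  have hWd : ContDiffAt ℝ k W (1, b₀) :=
    contDiffAt_fixedPoint (c := 3 / 4) (by exact_mod_cast hk) (by norm_num) (by norm_num)
      (hd.contDiffAt_orbitMap hk hgk hg hs δ b₀ (W (1, b₀))) hlip hWfix
  have hφ : ContDiffAt ℝ k (fun p : E × ℝ => (p.2 / t₀, p.1)) (b₀, t₀) := by fun_prop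
  have hev : (fun p : E × ℝ => U p.1 p.2) = fun p =>
      (evalCLM ℝ t₀ : (ℝ →ᵇ E) →L[ℝ] E) (W (p.2 / t₀, p.1)) := by
    ext p
    change U p.1 p.2 = U p.1 (p.2 / t₀ * t₀)
    rw [div_mul_cancel₀ _ ht₀.ne']
  rw [hev]
  have hWd' : ContDiffAt ℝ k W ((fun p : E × ℝ => (p.2 / t₀, p.1)) (b₀, t₀)) := by
    simpa only [div_self ht₀.ne'] using hWd
  exact (evalCLM ℝ t₀ : (ℝ →ᵇ E) →L[ℝ] E).contDiff.contDiffAt.comp (b₀, t₀)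
    (ContDiffAt.comp (g := W) (b₀, t₀) hWd' hφ)

/-- Backward-in-time Grönwall estimate for the orbits. -/
theorem exists_norm_sub_le_mul_norm_orbit_sub (hd : HasExpDichotomy A P a c) (hg : Continuous g)
    (hs : HasCompactSupport g) {L δ : ℝ}
    (hL : ∀ z y y', ‖g (z, y) - g (z, y')‖ ≤ L * ‖y - y'‖) (hL0 : 0 ≤ L) (hδ : 0 ≤ δ)
    {U : E → ℝ →ᵇ E} (hU : ∀ b, hd.orbitMap hg hs δ ((1, b), U b) = U b) {t : ℝ} (ht : 0 ≤ t) :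
    ∃ C, ∀ b b', ‖P b - P b'‖ ≤ C * ‖U b t - U b' t‖ := by
  set Λ : NNReal := (‖A‖ + δ * L).toNNReal with hΛ
  refine ⟨‖P‖ * Real.exp (Λ * t), fun b b' => ?_⟩
  -- This is the vector field of the time-reversed orbits `s ↦ U b (t - s)`, which reach the initial
  -- values at `s = t`.
  have hv : ∀ s, LipschitzWith Λ (fun y => -(A y - decayCurve δ 1 (t - s) •
      g (decayCurve δ 1 (t - s), y))) := by
    intro s
    refine LipschitzWith.of_dist_le_mul fun y y' => ?_
    rw [dist_eq_norm, dist_eq_norm]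
    set ζ := decayCurve δ 1 (t - s) with hζ
    have h1 : -(A y - ζ • g (ζ, y)) - -(A y' - ζ • g (ζ, y')) =
        ζ • (g (ζ, y) - g (ζ, y')) - A (y - y') := by
      rw [map_sub, smul_sub]; abel
    rw [h1]
    refine (norm_sub_le _ _).trans ?_
    rw [norm_smul, Real.norm_eq_abs, hΛ, Real.coe_toNNReal _ (by positivity), add_mul, add_comm, mul_assoc]
    gcongr
    · exact A.le_opNorm _
    · exact abs_decayCurve_le hδ _ _
    · exact hL _ _ _
  have hder : ∀ b, ∀ s ∈ Ico 0 t, HasDerivWithinAt (fun s => U b (t - s))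
      (-(A (U b (t - s)) - decayCurve δ 1 (t - s) • g (decayCurve δ 1 (t - s), U b (t - s))))
      (Ici s) s := by
    intro b s hs'
    have h1 := hd.hasDerivAt_of_orbitMap_eq_self hg hs (hU b) (sub_pos.2 hs'.2)
    have h2 : HasDerivAt (fun s : ℝ => t - s) (-1) s := by
      simpa using (hasDerivAt_id s).const_sub t
    refine (h1.scomp s h2).hasDerivWithinAt.congr_deriv ?_
    rw [neg_one_smul]
  have hcont : ∀ b, ContinuousOn (fun s => U b (t - s)) (Icc 0 t) := fun b =>
    ((U b).continuous.comp (by fun_prop)).continuousOn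
  have key := dist_le_of_trajectories_ODE (v := fun s y => -(A y - decayCurve δ 1 (t - s) •
      g (decayCurve δ 1 (t - s), y))) hv (hcont b) (hder b) (hcont b') (hder b') le_rfl t ⟨ht, le_rfl⟩
  simp only [sub_self, sub_zero, dist_eq_norm] at key
  rw [← hd.apply_zero_of_orbitMap_eq_self hg hs (hU b),
    ← hd.apply_zero_of_orbitMap_eq_self hg hs (hU b'), ← map_sub]
  refine (P.le_opNorm _).trans ?_
  rw [mul_assoc, mul_comm (Real.exp _)]
  gcongr

end HasExpDichotomy

end Orbits

/-! ### Cutting off the nonlinearity. -/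

section Cutoff

/-- Cutting off a `C^k` map near a point of its domain. -/
theorem ContDiffOn.exists_contDiff_hasCompactSupport {X F : Type*} [NormedAddCommGroup X]
    [NormedSpace ℝ X] [FiniteDimensional ℝ X] [NormedAddCommGroup F] [NormedSpace ℝ F] {k : ℕ}
    {D : Set X} (hD : IsOpen D) {x₀ : X} (hx₀ : x₀ ∈ D) {g : X → F} (hg : ContDiffOn ℝ k g D) :
    ∃ G : X → F, ContDiff ℝ k G ∧ HasCompactSupport G ∧
      ∃ r > 0, Metric.ball x₀ r ⊆ D ∧ EqOn G g (Metric.ball x₀ r) := by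
  obtain ⟨ε, hε, hεD⟩ := Metric.isOpen_iff.1 hD x₀ hx₀
  let χ : ContDiffBump x₀ := ⟨ε / 3, ε / 2, by positivity, by linarith⟩
  have hsupp : tsupport χ ⊆ D := by
    rw [χ.tsupport_eq]
    exact (Metric.closedBall_subset_ball (by change ε / 2 < ε; linarith)).trans hεD
  refine ⟨fun x => χ x • g x, ?_, ?_, ε / 3, by positivity, ?_, ?_⟩
  · rw [contDiff_iff_contDiffAt]
    intro x
    by_cases hx : x ∈ D
    · exact χ.contDiffAt.smul (hg.contDiffAt (hD.mem_nhds hx))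
    · have h0 : (fun x => χ x • g x) =ᶠ[𝓝 x] fun _ => 0 := by
        have := (isClosed_tsupport χ).isOpen_compl.mem_nhds (fun h => hx (hsupp h) : x ∈ (tsupport χ)ᶜ)
        filter_upwards [this] with y hy
        rw [image_eq_zero_of_notMem_tsupport hy, zero_smul]
      exact contDiffAt_const.congr_of_eventuallyEq h0
  · exact χ.hasCompactSupport.smul_right
  · exact (Metric.ball_subset_ball (by linarith)).trans hεD
  · intro x hx
    change χ x • g x = g x
    rw [χ.one_of_mem_closedBall (Metric.ball_subset_closedBall hx), one_smul]

end Cutoff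

/-! ### The change of variables `z = δ exp (-t)`. -/

section LogTime

theorem HasDerivAt.comp_log_div {F : Type*} [NormedAddCommGroup F] [NormedSpace ℝ F] {u : ℝ → F}
    {u' : F} {δ z : ℝ} (hδ : 0 < δ) (hz : 0 < z) (hu : HasDerivAt u u' (Real.log (δ / z))) :
    HasDerivAt (fun z => u (Real.log (δ / z))) (-z⁻¹ • u') z := by
  have h1 : HasDerivAt (fun z => Real.log (δ / z)) (-z⁻¹) z := by
    have h2 : (fun z => Real.log δ - Real.log z) =ᶠ[𝓝 z] fun z => Real.log (δ / z) := by
      filter_upwards [lt_mem_nhds hz] with w hw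
      rw [Real.log_div hδ.ne' hw.ne']
    exact ((Real.hasDerivAt_log hz.ne').const_sub _).congr_of_eventuallyEq h2.symm
  exact hu.scomp z h1

theorem HasDerivAt.comp_mul_exp_neg {F : Type*} [NormedAddCommGroup F] [NormedSpace ℝ F] {y : ℝ → F}
    {y' : F} {δ t : ℝ} (hy : HasDerivAt y y' (δ * Real.exp (-t))) :
    HasDerivAt (fun t => y (δ * Real.exp (-t))) (-((δ * Real.exp (-t)) • y')) t := by
  have h1 : HasDerivAt (fun t => δ * Real.exp (-t)) (-(δ * Real.exp (-t))) t := by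
    have := ((hasDerivAt_neg t).exp).const_mul δ
    exact this.congr_deriv (by ring)
  exact (hy.scomp t h1).congr_deriv (neg_smul _ _)

theorem log_div_pos_of_mem_Ioo {δ z : ℝ} (hz : z ∈ Ioo 0 δ) : 0 < Real.log (δ / z) :=
  Real.log_pos ((one_lt_div hz.1).2 hz.2)

theorem mul_exp_neg_log_div {δ z : ℝ} (hδ : 0 < δ) (hz : 0 < z) :
    δ * Real.exp (-Real.log (δ / z)) = z := by
  rw [← Real.log_inv, Real.exp_log (by positivity)]
  field_simp

theorem mul_exp_neg_mem_Ioo {δ t : ℝ} (hδ : 0 < δ) (ht : 0 < t) :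
    δ * Real.exp (-t) ∈ Ioo 0 δ := by
  refine ⟨by positivity, ?_⟩
  have : Real.exp (-t) < 1 := by
    rw [← Real.exp_zero]
    exact Real.exp_lt_exp.2 (neg_lt_zero.2 ht)
  nlinarith

end LogTime

/-! ### Extending bounded orbits to time zero. -/

section Extension
open scoped BoundedContinuousFunction

/-- A bounded curve on `(0, ∞)` with bounded derivative extends continuously to `0`. -/
theorem exists_boundedContinuous_extension {m : ℕ} {x x' : ℝ → (Fin m → ℝ)} {ρ Λ : ℝ}
    (hρ : ∀ t, 0 < t → ‖x t‖ ≤ ρ) (hx : ∀ t, 0 < t → HasDerivAt x (x' t) t)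
    (hΛ : ∀ t, 0 < t → ‖x' t‖ ≤ Λ) :
    ∃ u : ℝ →ᵇ (Fin m → ℝ), (∀ t, 0 < t → u t = x t) ∧ (∀ t, u t = u (max t 0)) ∧
      ∀ t, ‖u t‖ ≤ ρ := by
  -- The bounded derivative makes `x` Lipschitz, so a Lipschitz extension to all of ℝ supplies the
  -- value at `0`.
  have hlip : LipschitzOnWith Λ.toNNReal x (Ioi 0) :=
    (convex_Ioi 0).lipschitzOnWith_of_nnnorm_hasDerivWithin_le
      (fun t ht => (hx t ht).hasDerivWithinAt) (fun t ht => by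
        rw [← NNReal.coe_le_coe, coe_nnnorm]
        exact (hΛ t ht).trans (Real.le_coe_toNNReal _))
  obtain ⟨v, hv, hveq⟩ := hlip.extend_pi
  have hbd : ∀ t, 0 ≤ t → ‖v t‖ ≤ ρ := by
    intro t ht
    have hcl : IsClosed {t | ‖v t‖ ≤ ρ} := isClosed_le hv.continuous.norm continuous_const
    have hsub : Ioi (0 : ℝ) ⊆ {t | ‖v t‖ ≤ ρ} := fun t ht => by
      rw [mem_ofPred_eq, ← hveq ht]; exact hρ t ht
    have := hcl.closure_subset_iff.2 hsub
    rw [closure_Ioi] at this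
    exact this ht
  refine ⟨BoundedContinuousFunction.ofNormedAddCommGroup (fun t => v (max t 0))
    (hv.continuous.comp (continuous_id.max continuous_const)) ρ
    (fun t => hbd _ (le_max_right t 0)), fun t ht => ?_, fun t => ?_,
    fun t => hbd _ (le_max_right t 0)⟩
  · change v (max t 0) = x t
    rw [max_eq_left ht.le, hveq ht]
  · change v (max t 0) = v (max (max t 0) 0)
    simp

end Extension

/-! ### Coordinates on the stable subspace, and the rank criterion. -/

section Parametrization

theorem LinearMap.exists_parametrization_range {E : Type*} [NormedAddCommGroup E]
    [NormedSpace ℝ E] [FiniteDimensional ℝ E] (P : E →L[ℝ] E) {r : ℕ}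
    (hr : Module.finrank ℝ (LinearMap.range P.toLinearMap) = r) :
    ∃ J : (Fin r → ℝ) →L[ℝ] E, Function.Injective J ∧ ∀ v, (∃ b, J b = v) ↔ ∃ w, P w = v := by
  have e : (Fin r → ℝ) ≃ₗ[ℝ] LinearMap.range P.toLinearMap :=
    LinearEquiv.ofFinrankEq _ _ (by simp [hr])
  refine ⟨((LinearMap.range P.toLinearMap).subtype.comp e.toLinearMap).toContinuousLinearMap,
    Subtype.val_injective.comp e.injective, fun v => ⟨?_, ?_⟩⟩
  · rintro ⟨b, rfl⟩
    obtain ⟨w, hw⟩ := (e b).2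
    exact ⟨w, hw⟩
  · rintro ⟨w, rfl⟩
    exact ⟨e.symm ⟨P w, w, rfl⟩, by simp⟩

/-- The derivative of a map with a linear lower bound on increments is injective. -/
theorem injective_fderiv_of_norm_sub_le {E F : Type*} [NormedAddCommGroup E] [NormedSpace ℝ E]
    [NormedAddCommGroup F] [NormedSpace ℝ F] {f : E → F} {x : E} (hf : DifferentiableAt ℝ f x)
    {C : ℝ} (hC : ∀ᶠ y in 𝓝 x, ‖y - x‖ ≤ C * ‖f y - f x‖) :
    Function.Injective (fderiv ℝ f x) := by
  rw [injective_iff_map_eq_zero]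
  intro v hv
  have hline : HasDerivAt (fun s : ℝ => f (x + s • v)) 0 0 := by
    have h1 : HasDerivAt (fun s : ℝ => x + s • v) v 0 := by
      simpa using ((hasDerivAt_id (0 : ℝ)).smul_const v).const_add x
    have h2 : HasFDerivAt f (fderiv ℝ f x) (x + (0 : ℝ) • v) := by simpa using hf.hasFDerivAt
    exact (h2.comp_hasDerivAt (0 : ℝ) h1).congr_deriv hv
  have htend : Tendsto (fun s : ℝ => x + s • v) (𝓝[≠] 0) (𝓝 x) := by
    have : Continuous fun s : ℝ => x + s • v := by fun_prop
    simpa using (this.tendsto 0).mono_left (nhdsWithin_le_nhds (s := {0}ᶜ))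
  have h3 := hasDerivAt_iff_tendsto_slope.1 hline
  have h4 : Tendsto (fun s : ℝ => C * ‖slope (fun s : ℝ => f (x + s • v)) 0 s‖) (𝓝[≠] 0)
      (𝓝 (C * ‖(0 : F)‖)) := h3.norm.const_mul C
  rw [norm_zero, mul_zero] at h4
  have h5 : ∀ᶠ s : ℝ in 𝓝[≠] 0, ‖v‖ ≤ C * ‖slope (fun s : ℝ => f (x + s • v)) 0 s‖ := by
    filter_upwards [htend.eventually hC, self_mem_nhdsWithin] with s hs hs0
    have hs0 : 0 < |s| := abs_pos.2 hs0
    rw [add_sub_cancel_left, norm_smul, Real.norm_eq_abs] at hs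
    rw [slope_def_module, zero_smul, add_zero, sub_zero, norm_smul, norm_inv, Real.norm_eq_abs]
    have h6 : ‖v‖ = |s|⁻¹ * (|s| * ‖v‖) := by field_simp
    rw [h6]
    calc _ ≤ |s|⁻¹ * (C * ‖f (x + s • v) - f x‖) := by gcongr
      _ = _ := by ring
  exact norm_le_zero_iff.1 (ge_of_tendsto h4 h5)

end Parametrization

/-! ### Assembly of the main theorem. -/

theorem theorem1 (m k : ℕ) (hk : 1 ≤ k) (B : Matrix (Fin m) (Fin m) ℝ)
    (hB : NoImaginaryEigenvalue B)
    (D : Set (ℝ × (Fin m → ℝ))) (hD : IsOpen D) (h0 : (0, 0) ∈ D)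
    (g : ℝ × (Fin m → ℝ) → (Fin m → ℝ)) (hg : ContDiffOn ℝ k g D) :
    ∃ δ₀ > (0 : ℝ), ∃ ρ > (0 : ℝ), ∀ δ : ℝ, 0 < δ → δ ≤ δ₀ →
      ∃ (V : Set (Fin (numNegEigenvalues B) → ℝ))
        (Y : (Fin (numNegEigenvalues B) → ℝ) → ℝ → (Fin m → ℝ)),
        IsParameterFamily B D g k (numNegEigenvalues B) δ V Y ∧
        ∀ y : ℝ → (Fin m → ℝ), IsSolutionVanishingAtZero B D g δ y →
          (∀ z ∈ Ioo 0 δ, ‖y z‖ < ρ) → ∃ b ∈ V, EqOn y (Y b) (Ioo 0 δ) := by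
  obtain ⟨P, a, c, hd, hrank⟩ := hB.exists_hasExpDichotomy
  set A := matrixCLM ℝ (Fin m) B with hA
  have hAB : ∀ v, A v = B.mulVec v := fun v => rfl
  obtain ⟨J, hJinj, hJ⟩ := LinearMap.exists_parametrization_range P hrank
  have hPJ : ∀ b, P (J b) = J b := by
    intro b
    obtain ⟨w, hw⟩ := (hJ (J b)).1 ⟨b, rfl⟩
    rw [← hw]
    exact congrArg (fun Q : (Fin m → ℝ) →L[ℝ] (Fin m → ℝ) => Q w) hd.idem
  obtain ⟨G, hGk, hGs, r, hr, hrD, hGg⟩ := hg.exists_contDiff_hasCompactSupport hD h0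
  have hk0 : k ≠ 0 := by omega
  have hGc := hGk.continuous
  obtain ⟨M, hM⟩ := hGs.exists_bound_of_continuous hGc
  have hM0 : 0 ≤ M := (norm_nonneg _).trans (hM 0)
  obtain ⟨L, hLip⟩ := hGk.lipschitzWith_of_hasCompactSupport hGs (by exact_mod_cast hk0)
  have hL : ∀ z y y', ‖G (z, y) - G (z, y')‖ ≤ L * ‖y - y'‖ := by
    intro z y y'
    have := hLip.dist_le_mul (z, y) (z, y')
    rwa [dist_eq_norm, dist_eq_norm, Prod.mk_sub_mk, sub_self, Prod.norm_mk, norm_zero,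
      max_eq_right (norm_nonneg _)] at this
  have hL0 : (0 : ℝ) ≤ L := L.2
  set κ := ‖hd.greenCLM‖ with hκ
  have hκ0 : 0 ≤ κ := norm_nonneg _
  have hc0 := hd.const_nonneg
  have ha := hd.rate_pos
  set N := 2 * c / a * M with hN
  have hN0 : 0 ≤ N := by positivity
  -- This makes the stable part of an orbit at most `r / 4`. Together with `N * δ ≤ r / 2` for the
  -- forced part, it keeps orbits inside the ball of radius `r` on which `G = g`.
  set R := r / (4 * (c + 1)) with hR
  have hR0 : 0 < R := by positivity
  -- The three bounds give, in this order, `δ < r`, the contraction constant `1 / 2`, and `N * δ ≤ r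
  -- / 2`.
  set δ₀ := min (r / 2) (min (1 / (2 * (κ * L + 1))) (r / (2 * (N + 1)))) with hδ₀
  have hδ₀0 : 0 < δ₀ := by positivity
  -- The bound `r` lets a small solution see only `G`; the other bound puts its stable component at
  -- `t = 0` below `R`, that is, its parameter in `V`.
  set ρ := min r (R / (‖P‖ + 1)) with hρ
  have hρ0 : 0 < ρ := by positivity
  refine ⟨δ₀, hδ₀0, ρ, hρ0, fun δ hδ hδle => ?_⟩
  have hδr : δ < r := by
    have : δ ≤ r / 2 := hδle.trans (min_le_left _ _)
    linarith
  have hcon : κ * (δ * L) ≤ 1 / 2 := by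
    have h1 : δ ≤ 1 / (2 * (κ * L + 1)) := hδle.trans ((min_le_right _ _).trans (min_le_left _ _))
    rw [le_div_iff₀ (by positivity)] at h1
    nlinarith
  have hsmall : N * δ ≤ r / 2 := by
    have h1 : δ ≤ r / (2 * (N + 1)) := hδle.trans ((min_le_right _ _).trans (min_le_right _ _))
    rw [le_div_iff₀ (by positivity)] at h1
    nlinarith
  choose U hU using hd.exists_orbitMap_eq_self hGc hGs hL hL0 hδ.le hcon
  have hball : ∀ z ∈ Ioo 0 δ, ∀ y : Fin m → ℝ, ‖y‖ < r →
      (z, y) ∈ Metric.ball ((0 : ℝ), (0 : Fin m → ℝ)) r := by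
    intro z hz y hy
    rw [Metric.mem_ball, dist_eq_norm, Prod.mk_sub_mk, sub_zero, sub_zero, Prod.norm_mk,
      Real.norm_eq_abs, abs_of_pos hz.1]
    exact max_lt (hz.2.trans hδr) hy
  have hdecay : ∀ z ∈ Ioo 0 δ, decayCurve δ 1 (Real.log (δ / z)) = z := by
    intro z hz
    rw [decayCurve_of_nonneg δ zero_le_one (log_div_pos_of_mem_Ioo hz).le, one_mul,
      mul_exp_neg_log_div hδ hz.1]
  have hUr : ∀ b, ‖J b‖ < R → ∀ t, 0 ≤ t → ‖U (J b) t‖ < r := by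
    intro b hb t ht
    have h1 := hd.norm_le_of_orbitMap_eq_self hGc hGs hM hδ.le (hU (J b)) le_rfl ha zero_le_one ht
    rw [sub_zero, neg_zero, zero_mul, Real.exp_zero, mul_one] at h1
    have h2 : c * ‖J b‖ ≤ r / 4 := by
      calc c * ‖J b‖ ≤ (c + 1) * R := by gcongr; linarith
        _ = r / 4 := by rw [hR]; field_simp
    have h3 : 2 * c / a * (δ * M) = N * δ := by rw [hN]; ring
    linarith
  have hcd : ∀ b, ∀ z ∈ Ioo 0 δ, ContDiffAt ℝ k
      (fun p : (Fin (numNegEigenvalues B) → ℝ) × ℝ => U (J p.1) (Real.log (δ / p.2))) (b, z) := by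
    intro b z hz
    have h1 := hd.contDiffAt_orbit hk0 hGk hGc hGs hL hL0 hδ.le hcon hU (J b)
      (log_div_pos_of_mem_Ioo hz)
    have h2 : ContDiffAt ℝ k (fun p : (Fin (numNegEigenvalues B) → ℝ) × ℝ =>
        (J p.1, Real.log (δ / p.2))) (b, z) := by
      refine ContDiffAt.prodMk (by fun_prop) (ContDiffAt.log ?_ (div_pos hδ hz.1).ne')
      exact contDiffAt_const.div contDiffAt_snd hz.1.ne'
    exact ContDiffAt.comp (g := fun p : (Fin m → ℝ) × ℝ => U p.1 p.2) (b, z) h1 h2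
  obtain ⟨KJ, hKJ, hJanti⟩ := J.toLinearMap.exists_antilipschitzWith (LinearMap.ker_eq_bot.2 hJinj)
  -- This lower bound on increments yields both the injectivity in the parameter and the rank of the
  -- derivative.
  have hlow : ∀ z ∈ Ioo 0 δ, ∃ C, ∀ b b', ‖b - b'‖ ≤
      C * ‖U (J b) (Real.log (δ / z)) - U (J b') (Real.log (δ / z))‖ := by
    intro z hz
    obtain ⟨C, hC⟩ := hd.exists_norm_sub_le_mul_norm_orbit_sub hGc hGs hL hL0 hδ.le hU
      (log_div_pos_of_mem_Ioo hz).le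
    refine ⟨KJ * C, fun b b' => ?_⟩
    have h1 := hJanti.le_mul_dist b b'
    have h2 := hC (J b) (J b')
    rw [hPJ, hPJ] at h2
    rw [dist_eq_norm, dist_eq_norm] at h1
    calc _ ≤ _ := h1
      _ ≤ KJ * _ := mul_le_mul_of_nonneg_left h2 KJ.2
      _ = _ := by ring
  refine ⟨{b | ‖J b‖ < R}, fun b z => U (J b) (Real.log (δ / z)), ?_, ?_⟩
  · constructor
    · exact isOpen_lt J.continuous.norm continuous_const
    · simpa using hR0
    · intro b hb
      refine ⟨fun z hz => ?_, fun z hz => ?_, ?_⟩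
      · exact hrD (hball z hz _ (hUr b hb _ (log_div_pos_of_mem_Ioo hz).le))
      · refine ⟨_, HasDerivAt.comp_log_div hδ hz.1
          (hd.hasDerivAt_of_orbitMap_eq_self hGc hGs (hU (J b)) (log_div_pos_of_mem_Ioo hz)), ?_⟩
        rw [hdecay z hz, hGg (hball z hz _ (hUr b hb _ (log_div_pos_of_mem_Ioo hz).le)), smul_smul,
          mul_neg, mul_inv_cancel₀ hz.1.ne', neg_one_smul, ← hAB]
        abel
      · refine (hd.tendsto_zero_of_orbitMap_eq_self hGc hGs hδ.le (hU (J b))).comp ?_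
        refine Real.tendsto_log_atTop.comp ?_
        exact (tendsto_inv_nhdsGT_zero.const_mul_atTop hδ).congr fun z => (div_eq_mul_inv _ _).symm
    · rintro ⟨b, z⟩ ⟨_, hz⟩
      exact (hcd b z hz).contDiffWithinAt
    · intro z hz b _ b' _ hbb'
      obtain ⟨C, hC⟩ := hlow z hz
      have h1 := hC b b'
      simp only at hbb'
      rw [hbb', sub_self, norm_zero, mul_zero] at h1
      exact sub_eq_zero.1 (norm_le_zero_iff.1 h1)
    · intro z hz b _
      obtain ⟨C, hC⟩ := hlow z hz
      refine injective_fderiv_of_norm_sub_le (C := C) ?_ (Eventually.of_forall fun b' => hC b' b)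
      have h1 := (hcd b z hz).differentiableAt (by exact_mod_cast hk0)
      exact DifferentiableAt.comp (g := fun p : (Fin (numNegEigenvalues B) → ℝ) × ℝ =>
        U (J p.1) (Real.log (δ / p.2))) (f := fun b' => (b', z)) b h1
        (by fun_prop)
  · intro y hy hyρ
    set x : ℝ → (Fin m → ℝ) := fun t => y (δ * Real.exp (-t)) with hx
    have hxr : ∀ t, 0 < t → ‖x t‖ < r := fun t ht =>
      (hyρ _ (mul_exp_neg_mem_Ioo hδ ht)).trans_le (min_le_left _ _)
    have hdec : ∀ t, 0 < t → decayCurve δ 1 t = δ * Real.exp (-t) := fun t ht => by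
      rw [decayCurve_of_nonneg δ zero_le_one ht.le, one_mul]
    have hxd : ∀ t, 0 < t → HasDerivAt x
        (A (x t) - decayCurve δ 1 t • G (decayCurve δ 1 t, x t)) t := by
      intro t ht
      have hz := mul_exp_neg_mem_Ioo hδ ht
      obtain ⟨y', hy', heq⟩ := hy.equation _ hz
      refine hy'.comp_mul_exp_neg.congr_deriv ?_
      rw [hdec t ht, hGg (hball _ hz _ (hxr t ht)), hAB]
      rw [← heq]
      simp only [hx]
      abel
    obtain ⟨u, hux, huclip, hub⟩ := exists_boundedContinuous_extension (ρ := ρ)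
      (Λ := ‖A‖ * ρ + δ * M) (fun t ht => (hyρ _ (mul_exp_neg_mem_Ioo hδ ht)).le) hxd (by
        intro t ht
        refine (norm_sub_le _ _).trans (add_le_add ?_ ?_)
        · exact A.le_of_opNorm_le_of_le le_rfl (hyρ _ (mul_exp_neg_mem_Ioo hδ ht)).le
        · rw [norm_smul]
          exact mul_le_mul (abs_decayCurve_le hδ.le _ _) (hM _) (norm_nonneg _) hδ.le)
    -- The parameter is the stable component at `t = 0`, i.e. at the endpoint `z = δ`, where `y`
    -- itself is not controlled; hence the extension `u`.
    obtain ⟨b, hb⟩ := (hJ (P (u 0))).2 ⟨_, rfl⟩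
    have hufix : hd.orbitMap hGc hGs δ ((1, J b), u) = u := by
      refine hd.orbitMap_eq_self hGc hGs (fun t ht => ?_) huclip (by rw [hPJ, hb])
      have h1 : u =ᶠ[𝓝 t] x := by
        filter_upwards [lt_mem_nhds ht] with s hs using hux s hs
      rw [one_smul, hux t ht]
      exact (hxd t ht).congr_of_eventuallyEq h1
    have huU := hd.unique_of_orbitMap_eq_self hGc hGs hL hL0 hδ.le hcon hufix (hU (J b))
    refine ⟨b, ?_, fun z hz => ?_⟩
    · change ‖J b‖ < R
      rw [hb]
      calc ‖P (u 0)‖ ≤ ‖P‖ * ρ := P.le_of_opNorm_le_of_le le_rfl (hub 0)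
        _ < (‖P‖ + 1) * ρ := by nlinarith
        _ ≤ (‖P‖ + 1) * (R / (‖P‖ + 1)) := by gcongr; exact min_le_right _ _
        _ = R := by field_simp
    · change y z = U (J b) (Real.log (δ / z))
      rw [← huU, hux _ (log_div_pos_of_mem_Ioo hz)]
      rw [mul_exp_neg_log_div hδ hz.1]
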